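/- Let $\sigma$ be a finite or countable signature. A scheme of program of signature $\sigma$ is a pair $S=(n,G)$, where $n\ge 1$ and $G$ is a nonempty directed graph with a finite or countable set of nodes, one of which is the initial node. Each node is either a function node, labeled with an assignment $x_i\Leftarrow t$ ($t$ a term of $\sigma$) and having one unlabeled outgoing edge; or a predicate node, labeled with a first-order formula (with equality) of $\sigma$ and having two outgoing edges, labeled $1$ and $0$; or a terminal node, labeled with a number from $\omega$ and having no outgoing edges. A complete path of $S$ is a directed path from the initial node that is infinite or ends at a terminal node. Given a (nonempty) structure $U$ of signature $\sigma$ with universe $A$ and $\bar a=(a_0,\dots,a_{n-1})\in A^n$, run $S$ on $\bar a$: the variables $x_0,x_1,\dots$ are initially $a_0,\dots,a_{n-2},a_{n-1},a_{n-1},\dots$, function nodes perform their assignments, and at a predicate node the edge labeled $1$ or $0$ is taken according to whether its formula is true or false for the current values. This determines exactly one complete path, the one satisfiable in $U$ on $\bar a$; if it is finite, the implemented function takes at $\bar a$ the value attached to its terminal node, and otherwise it is undefined at $\bar a$. The scheme $S$ is total relative to $\{U\}$ if this function is defined on all of $A^n$. Two schemes with the same $n$ are strongly equivalent relative to $\{U\}$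 if for every $\bar a\in A^n$ their complete paths satisfiable in $U$ on $\bar a$ have the same length, the same node labels and the same edge labels. A finite tree-scheme is a scheme whose graph is a finite tree rooted at the initial node. The structure $U$ is program-saturated if every scheme of signature $\sigma$ that is total relative to $\{U\}$ is strongly equivalent relative to $\{U\}$ to a finite tree-scheme of signature $\sigma$. For a cardinal $\alpha$, a theory (a nonempty set of sentences of $\sigma$) is $\alpha$-categorical if it has a model of cardinality $\alpha$ and any two of its models of cardinality $\alpha$ are isomorphic. Each of the following structures is, for some cardinal $\alpha$, a model of cardinality $\alpha$ of an $\alpha$-categorical theory, and each is program-saturated: 1. the countable atomless Boolean algebra (with $0\neq 1$), in the signature of join, meet, complement, $0$, $1$; 2. every abelian group, in the signature $\{+,0\}$, all of whose elements $g$ satisfy $pg=0$, where $p$ is a prime number; 3. every uncountable divisible torsion-free abelian group, in the signature $\{+,0\}$; in particular, the additive group of real numbers $(\mathbb{R};+,0)$; 4. every uncountable algebraically closed field of characteristic zero or $p$, where $p$ is a prime number, in the signature $\{+,\cdot,0,1\}$; in particular, the field of complex numbers $(\mathbb{C};+,\cdot,0,1)$. -/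

import Mathlib

open scoped FirstOrder Cardinal

namespace ProgSat

/-! ### Schemes of programs -/

/-- What is attached to a node of a scheme: a function node carries an assignment `x_i ⇐ t`
and has one unlabeled outgoing edge, to `next`; a predicate node carries a formula and has one
outgoing edge labeled `1`, to `next₁`, and one labeled `0`, to `next₀`; a terminal node carries
a number and has no outgoing edges. The variables are `x_i`, `i : ℕ`. -/
inductive NodeData (L : FirstOrder.Language.{0, 0}) (N : Type) : Type
  | function (i : ℕ) (t : L.Term ℕ) (next : N)
  | predicate (φ : L.Formula ℕ) (next₁ next₀ : N)
  | terminal (k : ℕ)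

/-- The label of a node, without the outgoing edges. -/
inductive NodeLabel (L : FirstOrder.Language.{0, 0}) : Type
  | function (i : ℕ) (t : L.Term ℕ)
  | predicate (φ : L.Formula ℕ)
  | terminal (k : ℕ)

/-- A scheme `(n, G)` of signature `L`, with set of input variables `x_0, …, x_{n-1}`; it is
only used for `n ≠ 0`. -/
structure Scheme (L : FirstOrder.Language.{0, 0}) (n : ℕ) where
  /-- the nodes of the graph `G` -/
  Node : Type
  /-- the set of nodes is finite or countable -/
  countable : Countable Node
  /-- labels and outgoing edges of the nodes -/
  data : Node → NodeData L Node
  /-- the initial node -/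
  start : Node

namespace Scheme

variable {L : FirstOrder.Language.{0, 0}} {n : ℕ}

/-- The label of a node. -/
def label (S : Scheme L n) (w : S.Node) : NodeLabel L :=
  match S.data w with
  | .function i t _ => .function i t
  | .predicate φ _ _ => .predicate φ
  | .terminal k => .terminal k

/-- `S.Edge w d v`: an edge labeled `d` leads from `w` to `v`. Here `none` means that the edge is
not labeled, and `some true`, `some false` are the labels `1`, `0`. -/
def Edge (S : Scheme L n) (w : S.Node) (d : Option Bool) (v : S.Node) : Prop :=
  match S.data w with
  | .function _ _ next => d = none ∧ v = next
  | .predicate _ next₁ next₀ => (d = some true ∧ v = next₁) ∨ (d = some false ∧ v = next₀)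
  | .terminal _ => False

/-- The graph of the scheme is a directed tree whose root is the initial node: no edge enters the
root, exactly one edge enters every other node, and every node is reachable from the root.
An edge is determined by its source and its label. -/
def IsTree (S : Scheme L n) : Prop :=
  (∀ w d, ¬ S.Edge w d S.start) ∧
  (∀ v, v ≠ S.start → ∃! e : S.Node × Option Bool, S.Edge e.1 e.2 v) ∧
  (∀ v, Relation.ReflTransGen (fun w w' => ∃ d, S.Edge w d w') S.start v)

/-- Finite tree-schemes. -/
def IsFiniteTree (S : Scheme L n) : Prop :=
  S.IsTree ∧ Finite S.Node

/-- A complete path `node 0, edge 0, node 1, edge 1, …` of the scheme, with `length` edges: it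
starts at the initial node and is either infinite or ends at a terminal node. The values
`node i` with `i > length` and `edge i` with `i ≥ length` are not part of the path, and nothing
below depends on them. -/
structure CompletePath (S : Scheme L n) where
  /-- the number of edges -/
  length : ℕ∞
  /-- the nodes -/
  node : ℕ → S.Node
  /-- the labels of the edges -/
  edge : ℕ → Option Bool
  node_zero : node 0 = S.start
  edge_spec : ∀ i : ℕ, (i : ℕ∞) < length → S.Edge (node i) (edge i) (node (i + 1))
  terminal_of_length_eq : ∀ m : ℕ, length = m → ∃ k, S.label (node m) = .terminal k

namespace CompletePath

variable {S : Scheme L n}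

/-- The sequence of terms in the variables `x_0, …, x_{n-1}` attached to the `i`-th node of the
path: the `j`-th term expresses the current value of `x_j` through the inputs. Initially this is
`x_0, x_1, …, x_{n-2}, x_{n-1}, x_{n-1}, x_{n-1}, …`. -/
def terms [NeZero n] (τ : S.CompletePath) : ℕ → ℕ → L.Term (Fin n)
  | 0 => fun j => FirstOrder.Language.Term.var
      ⟨min j (n - 1), lt_of_le_of_lt (min_le_right _ _) (Nat.sub_lt (NeZero.pos n) one_pos)⟩
  | i + 1 =>
    match S.label (τ.node i) with
    | .function j t => Function.update (τ.terms i) j (t.subst (τ.terms i))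
    | .predicate _ => τ.terms i
    | .terminal _ => τ.terms i

/-- The set of formulas with free variables among `x_0, …, x_{n-1}` that correspond to the
predicate nodes of the path. -/
def formulas [NeZero n] (τ : S.CompletePath) : Set (L.Formula (Fin n)) :=
  {ψ | ∃ (i : ℕ) (φ : L.Formula ℕ), (i : ℕ∞) < τ.length ∧ S.label (τ.node i) = .predicate φ ∧
    ((τ.edge i = some true ∧ ψ = FirstOrder.Language.BoundedFormula.subst φ (τ.terms i)) ∨
      (τ.edge i = some false ∧ ψ = (FirstOrder.Language.BoundedFormula.subst φ (τ.terms i)).not))}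

/-- The path is satisfiable in the structure `A` on the tuple `a`. -/
def SatisfiableOn [NeZero n] (τ : S.CompletePath) {A : Type*} [L.Structure A]
    (a : Fin n → A) : Prop :=
  ∀ ψ ∈ τ.formulas, ψ.Realize a

/-- Isomorphic complete paths: same length, same labels of nodes, same labels of edges. -/
def Isomorphic {S₁ S₂ : Scheme L n} (τ₁ : S₁.CompletePath) (τ₂ : S₂.CompletePath) : Prop :=
  τ₁.length = τ₂.length ∧
  (∀ i : ℕ, (i : ℕ∞) ≤ τ₁.length → S₁.label (τ₁.node i) = S₂.label (τ₂.node i)) ∧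
  (∀ i : ℕ, (i : ℕ∞) < τ₁.length → τ₁.edge i = τ₂.edge i)

end CompletePath

/-- `k` is the number attached to the terminal node of a finite complete path of `S` that is
satisfiable in `A` on `a`. -/
def Outputs [NeZero n] (S : Scheme L n) {A : Type*} [L.Structure A] (a : Fin n → A) (k : ℕ) :
    Prop :=
  ∃ (τ : S.CompletePath) (m : ℕ), τ.SatisfiableOn a ∧ τ.length = m ∧
    S.label (τ.node m) = .terminal k

/-- The partial function `A ^ n → ℕ` implemented by the program `(S, A)`. -/
noncomputable def implements [NeZero n] (S : Scheme L n) (A : Type*) [L.Structure A] :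
    (Fin n → A) →. ℕ :=
  fun a => ⟨∃ k, S.Outputs a k, fun h => h.choose⟩

end Scheme

/-! ### Program-saturated classes and structures -/

/-- Structures of signature `L`; as models (of the empty theory) in the sense of Mathlib, they are
nonempty. -/
abbrev Struc (L : FirstOrder.Language.{0, 0}) : Type _ := FirstOrder.Language.Theory.ModelType.{0, 0} (∅ : L.Theory)

/-- The scheme `S` is total relative to the class `K`. -/
def TotalRel {L : FirstOrder.Language.{0, 0}} {n : ℕ} [NeZero n] (K : Set (Struc L)) (S : Scheme L n) :
    Prop :=
  ∀ U ∈ K, ∀ a : Fin n → U, a ∈ (S.implements U).Dom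

/-- Two schemes (with the same number of input variables) are strongly equivalent relative to the
class `K`. -/
def StronglyEquivalent {L : FirstOrder.Language.{0, 0}} {n : ℕ} [NeZero n] (K : Set (Struc L))
    (S₁ S₂ : Scheme L n) : Prop :=
  ∀ U ∈ K, ∀ a : Fin n → U, ∀ (τ₁ : S₁.CompletePath) (τ₂ : S₂.CompletePath),
    τ₁.SatisfiableOn a → τ₂.SatisfiableOn a → τ₁.Isomorphic τ₂

/-- The class `K` is program-saturated: every scheme that is total relative to `K` is strongly
equivalent relative to `K` to a finite tree-scheme. -/
def ClassProgramSaturated {L : FirstOrder.Language.{0, 0}} (K : Set (Struc L)) : Prop :=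
  ∀ (n : ℕ) [NeZero n] (S : Scheme L n), TotalRel K S →
    ∃ S' : Scheme L n, S'.IsFiniteTree ∧ StronglyEquivalent K S S'

/-- The structure `A` is program-saturated: the class `{A}` is. -/
def ProgramSaturated (L : FirstOrder.Language.{0, 0}) (A : Type*) [L.Structure A] [Nonempty A] : Prop :=
  ClassProgramSaturated {FirstOrder.Language.Theory.ModelType.of (∅ : L.Theory) A}

/-! ### Categorical theories -/

/-- The theory `T` (a nonempty set of sentences) is `α`-categorical: it has a model of cardinality
`α`, and every two models of cardinality `α` are isomorphic. -/
def IsCategorical {L : FirstOrder.Language.{0, 0}} (α : Cardinal) (T : L.Theory) : Prop :=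
  Set.Nonempty T ∧ (∃ M : T.ModelType, #M = α) ∧ α.Categorical T

/-- For some cardinal `α`, `A` is a model of cardinality `α` of an `α`-categorical theory. -/
def IsModelOfCategorical (L : FirstOrder.Language.{0, 0}) (A : Type*) [L.Structure A] : Prop :=
  ∃ (α : Cardinal) (T : L.Theory), IsCategorical α T ∧ A ⊨ T ∧ #A = α

/-! ### Signatures of Boolean algebras, abelian groups and fields -/

/-- Function symbols of the signature of Boolean algebras. -/
inductive BoolFunc : ℕ → Type
  | sup : BoolFunc 2
  | inf : BoolFunc 2
  | compl : BoolFunc 1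
  | bot : BoolFunc 0
  | top : BoolFunc 0

/-- The signature of Boolean algebras: join, meet, complement, `0`, `1`. -/
def boolLang : FirstOrder.Language.{0, 0} := ⟨BoolFunc, fun _ => Empty⟩

/-- Function symbols of the signature of abelian groups. -/
inductive GroupFunc : ℕ → Type
  | add : GroupFunc 2
  | zero : GroupFunc 0

/-- The signature `{+, 0}` of abelian groups. -/
def groupLang : FirstOrder.Language.{0, 0} := ⟨GroupFunc, fun _ => Empty⟩

/-- Function symbols of the signature of fields. -/
inductive FieldFunc : ℕ → Type
  | add : FieldFunc 2
  | mul : FieldFunc 2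
  | zero : FieldFunc 0
  | one : FieldFunc 0

/-- The signature `{+, ·, 0, 1}` of fields. -/
def fieldLang : FirstOrder.Language.{0, 0} := ⟨FieldFunc, fun _ => Empty⟩

/-- A Boolean algebra as a structure. -/
instance boolStructure (B : Type*) [BooleanAlgebra B] : boolLang.Structure B where
  funMap
    | .sup, x => x 0 ⊔ x 1
    | .inf, x => x 0 ⊓ x 1
    | .compl, x => (x 0)ᶜ
    | .bot, _ => ⊥
    | .top, _ => ⊤
  RelMap r := Empty.elim r

/-- An abelian group as a structure. -/
instance groupStructure (G : Type*) [AddCommGroup G] : groupLang.Structure G where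
  funMap
    | .add, x => x 0 + x 1
    | .zero, _ => 0
  RelMap r := Empty.elim r

/-- A field as a structure. -/
instance fieldStructure (F : Type*) [Field F] : fieldLang.Structure F where
  funMap
    | .add, x => x 0 + x 1
    | .mul, x => x 0 * x 1
    | .zero, _ => 0
    | .one, _ => 1
  RelMap r := Empty.elim r

end ProgSat

/-!
Two facts give the theorem: a model of cardinality `α` of an `α`-categorical theory in a countable
signature is program-saturated, and each of the listed structures is such a model.

**Program-saturation.** For a scheme `S` there is a formula `S.runsFor k` saying that the computation
on the inputs makes at least `k` steps
(`Scheme.CompletePath.SatisfiableOn.realize_runs_iff`). If `S` is total relative to `{A}`, no tuple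
of `A` satisfies all of these formulas. If one of them, for `k = N`, is satisfied by no tuple at all,
then `S` is strongly equivalent to its unrolling to depth `N`, which is a finite tree
(`programSaturated_of_realize`). So it is enough that a decreasing sequence of nonempty sets
definable in `A` without parameters has a common point. By compactness and the Löwenheim–Skolem
theorem there is a common point in some model of the complete theory of `A` that has the cardinality
of `A` (`exists_model_realize`), and by categoricity this model is isomorphic to `A`
(`IsModelOfCategorical.programSaturated`); finite structures need no compactness.

**Categoricity.** The categorical theory is the complete theory of `A`, so it is to be shown that a
structure `M ≡ A` with `#M = #A` is isomorphic to `A`. The axioms of Boolean algebras, abelian groups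
and fields are transferred from `A` to `M`, sentence by sentence, which makes `M` an algebraic
structure of the same kind with the given operations. Then
* countable atomless Boolean algebras are isomorphic by back-and-forth
  (`nonempty_orderIso_of_countable`);
* groups of exponent `p` are vector spaces over `ZMod p`, whose cardinality determines the dimension;
* divisible torsion-free groups are vector spaces over the fraction field of `ℤ`, whose dimension is
  their cardinality if they are uncountable;
* uncountable algebraically closed fields are determined by characteristic and cardinality
  (Steinitz' theorem, in Mathlib).
-/

namespace ProgSat

open FirstOrder FirstOrder.Language

universe u

/-! ### Paths of schemes -/

namespace Scheme

variable {L : FirstOrder.Language.{0, 0}} {n : ℕ}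

theorem not_edge_of_label_eq_terminal {S : Scheme L n} {w v : S.Node} {d : Option Bool} {k : ℕ}
    (h : S.label w = .terminal k) : ¬ S.Edge w d v := by
  unfold label at h
  unfold Edge
  split at h <;> simp_all

namespace CompletePath

variable {S S₁ S₂ : Scheme L n} [NeZero n] {A : Type*} [L.Structure A] {a : Fin n → A}

/-- Whether the formula at a predicate node is true for the current values decides which edge a
satisfiable path takes. -/
theorem SatisfiableOn.edge_cases {τ : S.CompletePath} (h : τ.SatisfiableOn a) {i : ℕ}
    (hi : (i : ℕ∞) < τ.length) {φ : L.Formula ℕ} (hφ : S.label (τ.node i) = .predicate φ) :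
    (φ.Realize (fun j => (τ.terms i j).realize a) ∧ τ.edge i = some true) ∨
    (¬ φ.Realize (fun j => (τ.terms i j).realize a) ∧ τ.edge i = some false) := by
  have hs := τ.edge_spec i hi
  unfold label at hφ
  unfold Edge at hs
  split at hs <;> rename_i hd
  · simp [hd] at hφ
  · simp only [hd, NodeLabel.predicate.injEq] at hφ
    subst hφ
    rcases hs with hs | hs
    · refine .inl ⟨?_, hs.1⟩
      have := h _ ⟨i, _, hi, by simp only [label, hd]; rfl, .inl ⟨hs.1, rfl⟩⟩
      exact BoundedFormula.realize_subst.1 this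
    · refine .inr ⟨?_, hs.1⟩
      have := h _ ⟨i, _, hi, by simp only [label, hd]; rfl, .inr ⟨hs.1, rfl⟩⟩
      rw [Formula.realize_not] at this
      exact fun h' => this (BoundedFormula.realize_subst.2 h')
  · exact hs.elim

omit [NeZero n] in
theorem edge_eq_none {τ : S.CompletePath} {i : ℕ} (hi : (i : ℕ∞) < τ.length) {j : ℕ}
    {t : L.Term ℕ} (h : S.label (τ.node i) = .function j t) : τ.edge i = none := by
  have hs := τ.edge_spec i hi
  unfold label at h
  unfold Edge at hs
  split at hs <;> simp_all

/-- A path satisfiable on `a` is determined by `a`: two such paths of schemes that are related by a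
bisimulation `R` during the first `N` steps are isomorphic if the first one is shorter than `N`. -/
theorem Isomorphic.of_bisimulation {τ₁ : S₁.CompletePath} {τ₂ : S₂.CompletePath}
    (h₁ : τ₁.SatisfiableOn a) (h₂ : τ₂.SatisfiableOn a) {N : ℕ} (hN : τ₁.length < N)
    (R : ℕ → S₁.Node → S₂.Node → Prop) (hstart : R 0 S₁.start S₂.start)
    (hlabel : ∀ i < N, ∀ w v, R i w v → S₁.label w = S₂.label v)
    (hedge : ∀ i < N, ∀ w v d w' v', R i w v → S₁.Edge w d w' → S₂.Edge v d v' →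
      R (i + 1) w' v') : τ₁.Isomorphic τ₂ := by
  have hlt : ∀ i : ℕ, (i : ℕ∞) ≤ τ₁.length → i < N := fun i hi => by
    exact_mod_cast lt_of_le_of_lt hi hN
  have hedges : ∀ i : ℕ, (i : ℕ∞) < τ₁.length → (i : ℕ∞) < τ₂.length →
      R i (τ₁.node i) (τ₂.node i) → τ₁.terms i = τ₂.terms i → τ₁.edge i = τ₂.edge i := by
    intro i hi₁ hi₂ hR ht
    have hl := hlabel i (hlt i hi₁.le) _ _ hR
    cases h : S₁.label (τ₁.node i) with
    | function j t => rw [edge_eq_none hi₁ h, edge_eq_none hi₂ (hl ▸ h)]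
    | predicate φ =>
      have e₁ := h₁.edge_cases hi₁ h
      have e₂ := h₂.edge_cases hi₂ (hl ▸ h)
      rw [← ht] at e₂
      rcases e₁ with ⟨h₁, e₁⟩ | ⟨h₁, e₁⟩ <;> rcases e₂ with ⟨h₂, e₂⟩ | ⟨h₂, e₂⟩
      · rw [e₁, e₂]
      · exact absurd h₁ h₂
      · exact absurd h₂ h₁
      · rw [e₁, e₂]
    | terminal k => exact (not_edge_of_label_eq_terminal h (τ₁.edge_spec i hi₁)).elim
  have key : ∀ i : ℕ, (i : ℕ∞) ≤ τ₁.length → (i : ℕ∞) ≤ τ₂.length →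
      R i (τ₁.node i) (τ₂.node i) ∧ τ₁.terms i = τ₂.terms i := by
    intro i
    induction i with
    | zero => exact fun _ _ => ⟨by rwa [τ₁.node_zero, τ₂.node_zero], rfl⟩
    | succ i ih =>
      intro hi₁ hi₂
      have hi₁' : (i : ℕ∞) < τ₁.length :=
        lt_of_lt_of_le (by exact_mod_cast Nat.lt_succ_self i) hi₁
      have hi₂' : (i : ℕ∞) < τ₂.length :=
        lt_of_lt_of_le (by exact_mod_cast Nat.lt_succ_self i) hi₂
      obtain ⟨hR, ht⟩ := ih hi₁'.le hi₂'.le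
      have hiN := hlt i hi₁'.le
      refine ⟨hedge i hiN _ _ (τ₁.edge i) _ _ hR (τ₁.edge_spec i hi₁') ?_, ?_⟩
      · rw [hedges i hi₁' hi₂' hR ht]
        exact τ₂.edge_spec i hi₂'
      · simp only [terms, ← hlabel i hiN _ _ hR, ht]
  -- The path that ends first ends at a terminal node, and the node of the other path with the same
  -- number is terminal as well.
  have hlen : τ₁.length = τ₂.length := by
    rcases lt_trichotomy τ₁.length τ₂.length with h | h | h
    · obtain ⟨m, hm⟩ := ENat.ne_top_iff_exists.1 h.ne_top
      obtain ⟨k, hk⟩ := τ₁.terminal_of_length_eq m hm.symm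
      rw [hlabel m (hlt m hm.le) _ _ (key m hm.le (hm.trans_lt h).le).1] at hk
      exact (not_edge_of_label_eq_terminal hk (τ₂.edge_spec m (hm.trans_lt h))).elim
    · exact h
    · obtain ⟨m, hm⟩ := ENat.ne_top_iff_exists.1 h.ne_top
      obtain ⟨k, hk⟩ := τ₂.terminal_of_length_eq m hm.symm
      have hm' := hm.trans_lt h
      rw [← hlabel m (hlt m hm'.le) _ _ (key m hm'.le hm.le).1] at hk
      exact (not_edge_of_label_eq_terminal hk (τ₁.edge_spec m hm')).elim
  exact ⟨hlen, fun i hi => hlabel i (hlt i hi) _ _ (key i hi (hlen ▸ hi)).1,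
    fun i hi => hedges i hi (hlen ▸ hi) (key i hi.le (hlen ▸ hi.le)).1
      (key i hi.le (hlen ▸ hi.le)).2⟩

end CompletePath

/-! ### The length of a computation is definable -/

/-- `S.runs k w s` says that `S`, started at the node `w` with the terms `s` as the values of its
variables, makes at least `k` steps. -/
noncomputable def runs (S : Scheme L n) : ℕ → S.Node → (ℕ → L.Term (Fin n)) → L.Formula (Fin n)
  | 0, _, _ => ⊤
  | k + 1, w, s =>
    match S.data w with
    | .function i t next => S.runs k next (Function.update s i (t.subst s))
    | .predicate φ next₁ next₀ =>
      (BoundedFormula.subst φ s ⊓ S.runs k next₁ s) ⊔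
        ((BoundedFormula.subst φ s).not ⊓ S.runs k next₀ s)
    | .terminal _ => ⊥

/-- The terms `x_0, x_1, …, x_{n-1}, x_{n-1}, …` that are the values of the variables at the
beginning of a computation. -/
def initialTerms (L : FirstOrder.Language.{0, 0}) (n : ℕ) [NeZero n] : ℕ → L.Term (Fin n) :=
  fun j => Term.var
    ⟨min j (n - 1), lt_of_le_of_lt (min_le_right _ _) (Nat.sub_lt (NeZero.pos n) one_pos)⟩

/-- `S.runsFor k` says that `S` makes at least `k` steps on the inputs. -/
noncomputable def runsFor [NeZero n] (S : Scheme L n) (k : ℕ) : L.Formula (Fin n) :=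
  S.runs k S.start (initialTerms L n)

/-- Seen from the `i`-th node of a path satisfiable on `a`, `runs k` says that the path has at least
`k` more edges. -/
theorem CompletePath.SatisfiableOn.realize_runs_iff {S : Scheme L n} [NeZero n] {A : Type*}
    [L.Structure A] {a : Fin n → A} {τ : S.CompletePath} (h : τ.SatisfiableOn a) (k i : ℕ)
    (hi : (i : ℕ∞) ≤ τ.length) :
    (S.runs k (τ.node i) (τ.terms i)).Realize a ↔ ((i + k : ℕ) : ℕ∞) ≤ τ.length := by
  induction k generalizing i with
  | zero => simpa [runs] using hi
  | succ k ih =>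
    rcases hi.eq_or_lt with hi' | hi'
    · obtain ⟨m, hm⟩ := τ.terminal_of_length_eq i hi'.symm
      have h1 : ¬ ((i + (k + 1) : ℕ) : ℕ∞) ≤ τ.length := by
        rw [← hi']; norm_cast; omega
      refine iff_of_false ?_ h1
      unfold label at hm
      split at hm <;> rename_i hd <;> simp at hm
      simp [runs, hd]
    · have hs := τ.edge_spec i hi'
      have ih' := ih (i + 1) (by simpa using Order.add_one_le_of_lt hi')
      rw [← add_assoc, add_right_comm, ← ih']
      unfold Edge at hs
      split at hs <;> rename_i hd
      · simp [runs, hd, hs.2, terms, label]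
      · rename_i φ next₁ next₀
        have hl : S.label (τ.node i) = .predicate φ := by simp only [label, hd]
        have he := h.edge_cases hi' hl
        have hsub : (BoundedFormula.subst φ (τ.terms i)).Realize a default ↔
            φ.Realize (fun j => (τ.terms i j).realize a) := BoundedFormula.realize_subst
        have ht : τ.terms (i + 1) = τ.terms i := by simp only [terms, hl]
        simp only [runs, hd, ht, Formula.realize_sup, Formula.realize_inf, Formula.realize_not]
        simp only [Formula.Realize] at hsub he ⊢
        rw [hsub]
        rcases he with ⟨he, he'⟩ | ⟨he, he'⟩
        · have : τ.node (i + 1) = next₁ := by simpa [he'] using hs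
          simp [he, this]
        · have : τ.node (i + 1) = next₀ := by simpa [he'] using hs
          simp [he, this]
      · exact hs.elim
  
end Scheme

/-! ### Unrolling a scheme into a finite tree -/

namespace Scheme

variable {L : FirstOrder.Language.{0, 0}} {n : ℕ}

theorem Edge.unique {S : Scheme L n} {w v v' : S.Node} {d : Option Bool} (h : S.Edge w d v)
    (h' : S.Edge w d v') : v = v' := by
  unfold Edge at h h'
  split at h <;> simp_all
  rcases h with ⟨rfl, rfl⟩ | ⟨rfl, rfl⟩ <;> simp_all

/-- `S.Reaches l w` says that the edges labeled by the entries of `l`, from the last to the first,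
lead from the initial node to `w`. -/
def Reaches (S : Scheme L n) : List (Option Bool) → S.Node → Prop
  | [], w => w = S.start
  | d :: l, v => ∃ w, S.Reaches l w ∧ S.Edge w d v

theorem Reaches.unique {S : Scheme L n} {l : List (Option Bool)} {w w' : S.Node}
    (h : S.Reaches l w) (h' : S.Reaches l w') : w = w' := by
  induction l generalizing w w' with
  | nil => exact h.trans h'.symm
  | cons d l ih =>
    obtain ⟨v, hv, he⟩ := h
    obtain ⟨v', hv', he'⟩ := h'
    obtain rfl := ih hv hv'
    exact he.unique he'

/-- The nodes of the tree obtained by unrolling a scheme to depth `N`: the label sequences, last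
label first, of the directed paths from the initial node that have at most `N` edges. -/
abbrev UnrollNode (S : Scheme L n) (N : ℕ) : Type :=
  {l : List (Option Bool) // l.length ≤ N ∧ ∃ w, S.Reaches l w}

instance (S : Scheme L n) (N : ℕ) : Finite (S.UnrollNode N) :=
  ((List.finite_length_le (Option Bool) N).subset fun _ h => h.1).to_subtype

namespace UnrollNode

variable {S : Scheme L n} {N : ℕ}

/-- The node of the scheme at the end of a path. -/
noncomputable def target (p : S.UnrollNode N) : S.Node := p.2.2.choose

theorem reaches_target (p : S.UnrollNode N) : S.Reaches p.1 p.target := p.2.2.choose_spec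

open Classical in
/-- The path `p` prolonged by the edge labeled `d`. It is `p` itself, a value never used, if there
is no such edge or if `p` already has `N` edges. -/
noncomputable def snoc (p : S.UnrollNode N) (d : Option Bool) : S.UnrollNode N :=
  if h : (d :: p.1).length ≤ N ∧ ∃ w, S.Reaches (d :: p.1) w then ⟨d :: p.1, h⟩ else p

theorem snoc_val {p : S.UnrollNode N} (hp : p.1.length < N) {d : Option Bool} {v : S.Node}
    (h : S.Edge p.target d v) : (p.snoc d).1 = d :: p.1 := by
  rw [snoc, dif_pos ⟨hp, v, p.target, p.reaches_target, h⟩]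

end UnrollNode

/-- The scheme unrolled to depth `N`. The nodes at depth `N` become terminal
nodes, with the arbitrary number `0`. -/
noncomputable def unroll (S : Scheme L n) (N : ℕ) : Scheme L n where
  Node := S.UnrollNode N
  countable := inferInstance
  data p :=
    if p.1.length < N then
      match S.data p.target with
      | .function i t _ => .function i t (p.snoc none)
      | .predicate φ _ _ => .predicate φ (p.snoc (some true)) (p.snoc (some false))
      | .terminal k => .terminal k
    else .terminal 0
  start := ⟨[], Nat.zero_le N, S.start, rfl⟩

variable {S : Scheme L n} {N : ℕ}

theorem label_unroll {p : S.UnrollNode N} (hp : p.1.length < N) :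
    (S.unroll N).label p = S.label p.target := by
  unfold label unroll
  simp only [hp, if_true]
  cases S.data p.target <;> rfl

/-- In the unrolling an edge prolongs a path by its own label. The length bound that `p` has to satisfy
is part of `q` being a node. -/
theorem edge_unroll_iff {p q : S.UnrollNode N} {d : Option Bool} :
    (S.unroll N).Edge p d q ↔ q.1 = d :: p.1 := by
  by_cases hp : p.1.length < N
  · have key : q.1 = d :: p.1 ↔ (∃ v, S.Edge p.target d v) ∧ q = p.snoc d := by
      constructor
      · intro h
        obtain ⟨hl, v, hv⟩ := q.2
        rw [h] at hv
        obtain ⟨w, hw, he⟩ := hv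
        obtain rfl := hw.unique p.reaches_target
        exact ⟨⟨v, he⟩, Subtype.ext (h.trans (UnrollNode.snoc_val hp he).symm)⟩
      · rintro ⟨⟨v, he⟩, rfl⟩
        exact UnrollNode.snoc_val hp he
    rw [key]
    unfold Edge unroll
    simp only [hp, if_true]
    cases S.data p.target with
    | function i t next =>
      simp only [exists_and_left, exists_eq, and_true]
      constructor <;> rintro ⟨rfl, h⟩ <;> exact ⟨rfl, h⟩
    | predicate φ next₁ next₀ =>
      constructor
      · rintro (⟨rfl, h⟩ | ⟨rfl, h⟩)
        · exact ⟨⟨next₁, .inl ⟨rfl, rfl⟩⟩, h⟩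
        · exact ⟨⟨next₀, .inr ⟨rfl, rfl⟩⟩, h⟩
      · rintro ⟨⟨v, ⟨rfl, -⟩ | ⟨rfl, -⟩⟩, h⟩
        · exact .inl ⟨rfl, h⟩
        · exact .inr ⟨rfl, h⟩
    | terminal k => simp
  · refine iff_of_false ?_ fun h => hp ?_
    · unfold Edge unroll
      simp [hp]
    · have := q.2.1
      rw [h] at this
      exact this

theorem isFiniteTree_unroll (S : Scheme L n) (N : ℕ) : (S.unroll N).IsFiniteTree := by
  refine ⟨⟨fun w d h => ?_, fun v hv => ?_, fun v => ?_⟩,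
    inferInstanceAs (Finite (S.UnrollNode N))⟩
  · exact List.cons_ne_nil _ _ (edge_unroll_iff.1 h).symm
  · obtain ⟨_ | ⟨d, l⟩, hl, w, hw⟩ := v
    · exact (hv rfl).elim
    · obtain ⟨w', hw', -⟩ := id hw
      refine ⟨(⟨l, (Nat.le_succ _).trans hl, w', hw'⟩, d), edge_unroll_iff.2 rfl, ?_⟩
      rintro ⟨q, d'⟩ h
      have h := edge_unroll_iff.1 h
      obtain ⟨rfl, h⟩ := List.cons.inj h
      exact Prod.ext (Subtype.ext h.symm) rfl
  · obtain ⟨l, hl, w, hw⟩ := v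
    induction l generalizing w with
    | nil => exact .refl
    | cons d l ih =>
      obtain ⟨w', hw', -⟩ := id hw
      exact (ih ((Nat.le_succ _).trans hl) w' hw').tail ⟨d, edge_unroll_iff.2 rfl⟩

/-- If all computations of a scheme make fewer than `N` steps, the scheme and its unrolling to
depth `N` follow the same paths. -/
theorem CompletePath.Isomorphic.of_unroll [NeZero n] {A : Type*} [L.Structure A] {a : Fin n → A}
    {τ₁ : S.CompletePath} {τ₂ : (S.unroll N).CompletePath} (h₁ : τ₁.SatisfiableOn a)
    (h₂ : τ₂.SatisfiableOn a) (hN : τ₁.length < N) : τ₁.Isomorphic τ₂ := by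
  refine .of_bisimulation h₁ h₂ hN
    (fun i w (p : S.UnrollNode N) => p.1.length = i ∧ p.target = w) ⟨rfl, ?_⟩ ?_ ?_
  · exact (UnrollNode.reaches_target _).unique rfl
  · rintro i hi w p ⟨rfl, rfl⟩
    exact (label_unroll hi).symm
  · rintro i hi w p d w' q ⟨rfl, rfl⟩ h h'
    have h' : Subtype.val q = d :: p.1 := edge_unroll_iff.1 h'
    have hq := UnrollNode.reaches_target q
    rw [h'] at hq
    exact ⟨by rw [h']; rfl, hq.unique ⟨_, p.reaches_target, h⟩⟩

end Scheme

/-- A structure is program-saturated if every decreasing sequence of nonempty sets definable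
without parameters has a common point. -/
theorem programSaturated_of_realize {L : FirstOrder.Language.{0, 0}} {A : Type*} [L.Structure A]
    [Nonempty A]
    (hA : ∀ (n : ℕ) (ψ : ℕ → L.Formula (Fin n)),
      (∀ k (a : Fin n → A), (ψ (k + 1)).Realize a → (ψ k).Realize a) →
      (∀ k, ∃ a : Fin n → A, (ψ k).Realize a) → ∃ a : Fin n → A, ∀ k, (ψ k).Realize a) :
    ProgramSaturated L A := by
  intro n _ S hS
  have hS' : ∀ a : Fin n → A, ∃ (τ : S.CompletePath) (m : ℕ), τ.SatisfiableOn a ∧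
      τ.length = m := fun a => by
    obtain ⟨k, τ, m, h, hm, -⟩ := hS _ rfl a
    exact ⟨τ, m, h, hm⟩
  have hruns : ∀ (a : Fin n → A) (τ : S.CompletePath), τ.SatisfiableOn a → ∀ k : ℕ,
      (S.runsFor k).Realize a ↔ (k : ℕ∞) ≤ τ.length := fun a τ h k => by
    have := h.realize_runs_iff k 0 (by simp)
    rwa [τ.node_zero, zero_add] at this
  have hN : ∃ N, ∀ a : Fin n → A, ¬ (S.runsFor N).Realize a := by
    by_contra! hN
    obtain ⟨a, ha⟩ := hA n S.runsFor (fun k a h => by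
      obtain ⟨τ, m, hτ, hm⟩ := hS' a
      rw [hruns a τ hτ] at h ⊢
      exact le_trans (by exact_mod_cast Nat.le_succ k) h) hN
    obtain ⟨τ, m, h, hm⟩ := hS' a
    have := (hruns a τ h (m + 1)).1 (ha (m + 1))
    rw [hm] at this
    norm_cast at this
    omega
  obtain ⟨N, hN⟩ := hN
  refine ⟨S.unroll N, S.isFiniteTree_unroll N, ?_⟩
  rintro U rfl a τ₁ τ₂ h₁ h₂
  exact .of_unroll h₁ h₂ (lt_of_not_ge fun h => hN a ((hruns a τ₁ h₁ N).2 h))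

/-! ### Models of categorical theories are program-saturated -/

theorem elementarilyEquivalent_of_model_completeTheory {L : FirstOrder.Language.{0, 0}}
    {A M : Type*} [L.Structure A] [L.Structure M] (h : M ⊨ L.completeTheory A) : A ≅[L] M := by
  refine elementarilyEquivalent_iff.2 fun φ => ⟨fun hφ => h.realize_of_mem φ hφ, fun hφ => ?_⟩
  by_contra hA
  exact (Sentence.realize_not M).1 (h.realize_of_mem φ.not ((Sentence.realize_not A).2 hA)) hφ

/-- By compactness and the Löwenheim–Skolem theorem, some model of cardinality `#A` of the complete
theory of `A` realizes all `ψ k`. -/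
theorem exists_model_realize {L : FirstOrder.Language.{0, 0}} (hL : L.card ≤ ℵ₀) {A : Type*}
    [L.Structure A] [Infinite A] {n : ℕ} (ψ : ℕ → L.Formula (Fin n))
    (hψ : ∀ k (a : Fin n → A), (ψ (k + 1)).Realize a → (ψ k).Realize a)
    (hA : ∀ k, ∃ a : Fin n → A, (ψ k).Realize a) :
    ∃ (M : (L.completeTheory A).ModelType) (a : Fin n → M), #M = #A ∧ ∀ k, (ψ k).Realize a := by
  have hanti : ∀ j k (a : Fin n → A), j ≤ k → (ψ k).Realize a → (ψ j).Realize a := by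
    intro j k a hjk
    induction hjk with
    | refl => exact id
    | step _ ih => exact fun h => ih (hψ _ a h)
  let T : L[[Fin n]].Theory := (L.lhomWithConstants (Fin n)).onTheory (L.completeTheory A)
  have hsat : (T ∪ ⋃ k, {Formula.equivSentence (ψ k)}).IsSatisfiable := by
    have : (T ∪ ⋃ k, {Formula.equivSentence (ψ k)}) =
        ⋃ k, (T ∪ ⋃ j ≤ k, {Formula.equivSentence (ψ j)}) := by
      ext φ
      simp only [Set.mem_union, Set.mem_iUnion, Set.mem_singleton_iff, exists_prop]
      constructor
      · rintro (h | ⟨k, h⟩)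
        · exact ⟨0, .inl h⟩
        · exact ⟨k, .inr ⟨k, le_rfl, h⟩⟩
      · rintro ⟨k, h | ⟨j, -, h⟩⟩
        · exact .inl h
        · exact .inr ⟨j, h⟩
    -- A tuple satisfying `ψ k` interprets the new constants so that `ψ j` holds for all `j ≤ k`.
    rw [this, Theory.isSatisfiable_directed_union_iff]
    · intro k
      obtain ⟨a, ha⟩ := hA k
      let : (constantsOn (Fin n)).Structure A := constantsOn.structure a
      have hm : A ⊨ (T ∪ ⋃ j ≤ k, {Formula.equivSentence (ψ j)}) := by
        refine Theory.model_union_iff.2 ⟨(LHom.onTheory_model _ _).2 inferInstance, ⟨?_⟩⟩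
        intro φ hφ
        simp only [Set.mem_iUnion, Set.mem_singleton_iff, exists_prop] at hφ
        obtain ⟨j, hj, rfl⟩ := hφ
        exact (Formula.realize_equivSentence A (ψ j)).2 (hanti j k a hj ha)
      exact Theory.Model.isSatisfiable A
    · refine Monotone.directed_le fun k k' hk => Set.union_subset_union_right _ ?_
      exact Set.biUnion_subset_biUnion_left fun j hj => le_trans hj hk
  obtain ⟨N, hN⟩ : ∃ N : (T ∪ ⋃ k, {Formula.equivSentence (ψ k)}).ModelType, #N = #A := by
    refine Theory.exists_model_card_eq ⟨hsat.some, ?_⟩ _ (Cardinal.aleph0_le_mk A) ?_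
    · have h := (Theory.model_union_iff.1 hsat.some.is_model).1
      let := (L.lhomWithConstants (Fin n)).reduct hsat.some
      have : (L.lhomWithConstants (Fin n)).IsExpansionOn hsat.some :=
        LHom.isExpansionOn_reduct _ _
      exact (elementarilyEquivalent_of_model_completeTheory
        ((LHom.onTheory_model _ _).1 h)).infinite
    · refine le_trans ?_ (Cardinal.lift_le.2 (Cardinal.aleph0_le_mk A))
      simp only [card_withConstants, Cardinal.lift_aleph0, Cardinal.lift_le_aleph0]
      exact Cardinal.add_le_aleph0.2 ⟨by simpa using hL, by simp⟩
  have hN' := Theory.model_union_iff.1 N.is_model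
  let := (L.lhomWithConstants (Fin n)).reduct N
  have : (L.lhomWithConstants (Fin n)).IsExpansionOn N := LHom.isExpansionOn_reduct _ _
  have : N ⊨ L.completeTheory A := (LHom.onTheory_model _ _).1 hN'.1
  refine ⟨Theory.ModelType.of _ N, fun i => (L.con i : N), hN, fun k => ?_⟩
  exact (Formula.realize_equivSentence N (ψ k)).1
    (hN'.2.realize_of_mem _ (Set.mem_iUnion.2 ⟨k, rfl⟩))

/-- In a model `A` of a categorical theory of its cardinality, a decreasing sequence of nonempty
definable sets has a common point: it has one in a model of the same cardinality, which is
isomorphic to `A`. For finite `A` the sequence is eventually constant. -/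
theorem IsModelOfCategorical.programSaturated {L : FirstOrder.Language.{0, 0}} (hL : L.card ≤ ℵ₀)
    {A : Type*} [L.Structure A] [Nonempty A] (h : IsModelOfCategorical L A) :
    ProgramSaturated L A := by
  refine programSaturated_of_realize fun n ψ hψ hA => ?_
  rcases finite_or_infinite A with hfin | hinf
  · by_contra! hne
    choose k hk using hne
    obtain ⟨K, hK⟩ := (Set.finite_range k).bddAbove
    obtain ⟨a, ha⟩ := hA K
    refine hk a ?_
    have : ∀ j ≤ K, (ψ j).Realize a := fun j hj => by
      induction hj using Nat.decreasingInduction with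
      | self => exact ha
      | of_succ j _ ih => exact hψ j a ih
    exact this _ (hK ⟨a, rfl⟩)
  · obtain ⟨α, T, ⟨-, -, hT⟩, hAT, hα⟩ := h
    obtain ⟨M, a, hM, ha⟩ := exists_model_realize hL ψ hψ hA
    have hMT : M ⊨ T :=
      (elementarilyEquivalent_of_model_completeTheory M.is_model).theory_model_iff.1 hAT
    obtain ⟨e⟩ := hT (.of T M) (.of T A) (hM.trans hα) hα
    exact ⟨e ∘ a, fun k => (StrongHomClass.realize_formula e (ψ k)).2 (ha k)⟩

/-- If the elementarily equivalent structures of the same cardinality are isomorphic to `A`, then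
the complete theory of `A` is categorical. -/
theorem isModelOfCategorical_of_elementarilyEquivalent {L : FirstOrder.Language.{0, 0}}
    {A : Type*} [L.Structure A] [Nonempty A]
    (h : ∀ (M : Type _) [L.Structure M], A ≅[L] M → #M = #A → Nonempty (A ≃[L] M)) :
    IsModelOfCategorical L A := by
  refine ⟨#A, L.completeTheory A, ⟨⟨⊤, BoundedFormula.realize_top.2 trivial⟩, ⟨.of _ A, rfl⟩, fun M N hM hN => ?_⟩,
    inferInstance, rfl⟩
  obtain ⟨e⟩ := h M (elementarilyEquivalent_of_model_completeTheory M.is_model) hM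
  obtain ⟨e'⟩ := h N (elementarilyEquivalent_of_model_completeTheory N.is_model) hN
  exact ⟨e'.comp e.symm⟩

/-! ### Transfer of axioms between elementarily equivalent structures -/

/-- The universal closure of `φ`, which may itself contain quantifiers, holds in both structures or in
neither. -/
theorem _root_.FirstOrder.Language.ElementarilyEquivalent.forall_realize_iff
    {L : FirstOrder.Language.{0, 0}} {A M : Type*} [L.Structure A] [L.Structure M] (h : A ≅[L] M) {n : ℕ}
    (φ : L.BoundedFormula Empty n) :
    (∀ x : Fin n → A, φ.Realize default x) ↔ ∀ x : Fin n → M, φ.Realize default x := by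
  exact (BoundedFormula.realize_alls.symm.trans (h.realize_sentence φ.alls)).trans
    BoundedFormula.realize_alls

theorem vecCons_two_eq {M : Type*} (x : Fin 2 → M) : ![x 0, x 1] = x := by
  funext i
  fin_cases i <;> rfl

/-! ### Abelian groups -/

/-- The term `s + t`. -/
def groupAdd {α : Type} (s t : groupLang.Term α) : groupLang.Term α :=
  Functions.apply₂ (L := groupLang) GroupFunc.add s t

/-- The term `0`. -/
def groupZero {α : Type} : groupLang.Term α :=
  Constants.term (L := groupLang) GroupFunc.zero

/-- The term `t + ⋯ + t` with `n` summands. -/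
def groupNSMul {α : Type} (n : ℕ) (t : groupLang.Term α) : groupLang.Term α :=
  match n with
  | 0 => groupZero
  | n + 1 => groupAdd (groupNSMul n t) t

section

variable {G : Type*} [AddCommGroup G] {α : Type} (v : α → G)

@[simp]
theorem realize_groupAdd (s t : groupLang.Term α) :
    (groupAdd s t).realize v = s.realize v + t.realize v :=
  Term.realize_functions_apply₂

@[simp]
theorem realize_groupZero : (groupZero : groupLang.Term α).realize v = 0 :=
  Term.realize_constants

@[simp]
theorem realize_groupNSMul (n : ℕ) (t : groupLang.Term α) :
    (groupNSMul n t).realize v = n • t.realize v := by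
  induction n with
  | zero => simp [groupNSMul]
  | succ n ih => simp [groupNSMul, ih, succ_nsmul]

end

/-- A structure elementarily equivalent to an abelian group is an abelian group. -/
theorem exists_addCommGroup {G M : Type*} [AddCommGroup G] [inst : groupLang.Structure M]
    (h : G ≅[groupLang] M) : ∃ i : AddCommGroup M, @groupStructure M i = inst := by
  let : Add M := ⟨fun x y => Structure.funMap (L := groupLang) GroupFunc.add ![x, y]⟩
  let : Zero M := ⟨Structure.funMap (L := groupLang) GroupFunc.zero ![]⟩
  have hadd : ∀ {α : Type} (v : α → M) (s t : groupLang.Term α),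
      (groupAdd s t).realize v = s.realize v + t.realize v :=
    fun _ _ _ => Term.realize_functions_apply₂
  have hzero : ∀ {α : Type} (v : α → M), (groupZero : groupLang.Term α).realize v = 0 :=
    fun _ => Term.realize_constants
  have add_assoc' : ∀ x y z : M, x + y + z = x + (y + z) := fun x y z => by
    have := (h.forall_realize_iff (groupAdd (groupAdd (&0) (&1)) (&2) ='
      groupAdd (&0) (groupAdd (&1) (&2)) : groupLang.BoundedFormula Empty 3)).1
      (fun x => by simp [add_assoc]) ![x, y, z]
    simpa [hadd] using this
  have add_comm' : ∀ x y : M, x + y = y + x := fun x y => by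
    have := (h.forall_realize_iff (groupAdd (&0) (&1) =' groupAdd (&1) (&0) :
      groupLang.BoundedFormula Empty 2)).1 (fun x => by simp [add_comm]) ![x, y]
    simpa [hadd] using this
  have zero_add' : ∀ x : M, 0 + x = x := fun x => by
    have := (h.forall_realize_iff (groupAdd groupZero (&0) =' &0 :
      groupLang.BoundedFormula Empty 1)).1 (fun x => by simp) ![x]
    simpa [hadd, hzero] using this
  have neg' : ∀ x : M, ∃ y, y + x = 0 := fun x => by
    have := (h.forall_realize_iff (∃' (groupAdd (&1) (&0) =' groupZero) :
      groupLang.BoundedFormula Empty 1)).1 (fun x => by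
        simpa [Fin.snoc] using ⟨-x 0, neg_add_cancel _⟩) ![x]
    simpa [hadd, hzero, Fin.snoc] using this
  choose neg hneg using neg'
  let : Neg M := ⟨neg⟩
  refine ⟨{ add_assoc := add_assoc', add_comm := add_comm', zero_add := zero_add',
            add_zero := fun x => by rw [add_comm', zero_add'],
            neg_add_cancel := hneg, nsmul := nsmulRec, zsmul := zsmulRec }, ?_⟩
  refine Structure.ext ?_ ?_
  · funext n f x
    cases f with
    | add => exact congrArg (Structure.funMap (L := groupLang) GroupFunc.add) (vecCons_two_eq x)
    | zero =>
      exact congrArg (Structure.funMap (L := groupLang) GroupFunc.zero) (Subsingleton.elim ![] x)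
  · funext n r
    exact r.elim

/-- An additive isomorphism is an isomorphism of structures. -/
def groupEquiv {G H : Type*} [AddCommGroup G] [AddCommGroup H] (e : G ≃+ H) :
    G ≃[groupLang] H where
  toEquiv := e.toEquiv
  map_fun' f x := by
    cases f with
    | add => exact map_add e _ _
    | zero => exact map_zero e
  map_rel' r := r.elim

theorem card_groupLang_le : groupLang.card ≤ ℵ₀ := by
  have : Countable groupLang.Symbols := by
    have : Countable (Σ l, groupLang.Functions l) := by
      refine Function.Injective.countable (f := fun x : Σ l, GroupFunc l => x.1) ?_
      rintro ⟨_, _ | _⟩ ⟨_, _ | _⟩ h <;> simp_all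
    have : Countable (Σ l, groupLang.Relations l) :=
      have : IsEmpty (Σ l, groupLang.Relations l) := ⟨fun x => x.2.elim⟩
      inferInstance
    exact inferInstanceAs (Countable (_ ⊕ _))
  exact Cardinal.mk_le_aleph0

theorem ElementarilyEquivalent.forall_nsmul_eq_zero {G M : Type*} [AddCommGroup G]
    [AddCommGroup M] (h : G ≅[groupLang] M) {p : ℕ} (hG : ∀ g : G, p • g = 0) (g : M) :
    p • g = 0 := by
  have := (h.forall_realize_iff (groupNSMul p (&0) =' groupZero :
    groupLang.BoundedFormula Empty 1)).1 (fun x => by simp [hG]) ![g]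
  simpa using this

theorem ElementarilyEquivalent.exists_nsmul_eq {G M : Type*} [AddCommGroup G]
    [AddCommGroup M] (h : G ≅[groupLang] M) {n : ℕ} (hG : ∀ g : G, ∃ h, n • h = g) (g : M) :
    ∃ h, n • h = g := by
  have := (h.forall_realize_iff (∃' (groupNSMul n (&1) =' &0) :
    groupLang.BoundedFormula Empty 1)).1 (fun x => by simpa [Fin.snoc] using hG (x 0)) ![g]
  simpa [Fin.snoc] using this

theorem ElementarilyEquivalent.eq_zero_of_nsmul_eq_zero {G M : Type*} [AddCommGroup G]
    [AddCommGroup M] (h : G ≅[groupLang] M) {n : ℕ} (hG : ∀ g : G, n • g = 0 → g = 0) (g : M)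
    (hg : n • g = 0) : g = 0 := by
  have := (h.forall_realize_iff ((groupNSMul n (&0) =' groupZero).imp (&0 =' groupZero) :
    groupLang.BoundedFormula Empty 1)).1 (fun x => by simpa using hG (x 0)) ![g]
  simpa [hg] using this

/-- Complements `Module.Free.rank_eq_mk_of_infinite_lt`, which is about infinite fields. -/
theorem rank_eq_mk_of_finite_of_infinite {K : Type} {V : Type*} [Field K] [Finite K]
    [AddCommGroup V] [Module K V] [Infinite V] : Module.rank K V = #V := by
  let b := Module.Free.chooseBasis K V
  have : Infinite (Module.Free.ChooseBasisIndex K V) := by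
    by_contra hfin
    rw [not_infinite_iff_finite] at hfin
    have : Finite (Module.Free.ChooseBasisIndex K V →₀ K) :=
      Finite.of_injective _ DFunLike.coe_injective
    exact not_finite_iff_infinite.2 ‹Infinite V› (Finite.of_equiv _ b.repr.toEquiv.symm)
  rw [← b.mk_eq_rank'', b.repr.toEquiv.cardinal_eq, Cardinal.mk_finsupp_lift_of_infinite,
    Cardinal.lift_uzero, max_eq_left]
  exact (Cardinal.lift_le_aleph0.2 Cardinal.mk_le_aleph0).trans (Cardinal.aleph0_le_mk _)

/-- Vector spaces of the same cardinality over a finite field are isomorphic. -/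
theorem nonempty_linearEquiv_of_finite {K : Type} {V W : Type u} [Field K] [Finite K]
    [AddCommGroup V] [Module K V] [AddCommGroup W] [Module K W] (h : #V = #W) :
    Nonempty (V ≃ₗ[K] W) := by
  have := Fintype.ofFinite K
  obtain ⟨e⟩ := Cardinal.eq.1 h
  rcases finite_or_infinite V with hV | hV
  · have hW := Finite.of_equiv V e
    have := Fintype.ofFinite V
    have := Fintype.ofFinite W
    refine FiniteDimensional.nonempty_linearEquiv_of_finrank_eq ?_
    refine Nat.pow_right_injective (Fintype.one_lt_card (α := K)) ?_
    simp only [← Module.card_eq_pow_finrank, Fintype.card_congr e]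
  · have hW := Infinite.of_injective e e.injective
    refine nonempty_linearEquiv_of_rank_eq ?_
    rw [rank_eq_mk_of_finite_of_infinite, rank_eq_mk_of_finite_of_infinite, h]

/-- The fraction field of `ℤ` acts on a divisible torsion-free abelian group. -/
theorem nonempty_module_fractionRing {G : Type*} [AddCommGroup G]
    (hdiv : ∀ n : ℕ, n ≠ 0 → ∀ g : G, ∃ h : G, n • h = g)
    (htf : ∀ n : ℕ, n ≠ 0 → ∀ g : G, n • g = 0 → g = 0) :
    Nonempty (Module (FractionRing ℤ) G) := by
  -- Nonzero integers already act bijectively on `G`, so `G` is its own localization.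
  have : IsLocalizedModule (nonZeroDivisors ℤ) (LinearMap.id : G →ₗ[ℤ] G) := by
    have hinj : ∀ n : ℤ, n ≠ 0 → ∀ g : G, n • g = 0 → g = 0 := fun n hn g hg => by
      obtain ⟨k, rfl | rfl⟩ := n.eq_nat_or_neg <;>
        exact htf k (by simpa using hn) g (by simpa using hg)
    have hsurj : ∀ n : ℤ, n ≠ 0 → ∀ g : G, ∃ h, n • h = g := fun n hn g => by
      obtain ⟨k, rfl | rfl⟩ := n.eq_nat_or_neg <;>
        obtain ⟨h, rfl⟩ := hdiv k (by simpa using hn) g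
      · exact ⟨h, by simp⟩
      · exact ⟨-h, by simp⟩
    refine ⟨fun n => ?_, fun g => ⟨(g, 1), one_smul _ _⟩, fun h => ⟨1, by simpa using h⟩⟩
    have hn := nonZeroDivisors.ne_zero n.2
    refine (Module.End.isUnit_iff _).2 ⟨?_, fun g => hsurj n hn g⟩
    exact (injective_iff_map_eq_zero _).2 fun g hg => hinj n hn g hg
  exact ⟨IsLocalizedModule.module (nonZeroDivisors ℤ) (LinearMap.id : G →ₗ[ℤ] G)⟩

theorem isModelOfCategorical_of_prime_nsmul {p : ℕ} {G : Type*} [AddCommGroup G] (hp : p.Prime)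
    (hG : ∀ g : G, p • g = 0) : IsModelOfCategorical groupLang G := by
  refine isModelOfCategorical_of_elementarilyEquivalent fun M _ h hM => ?_
  obtain ⟨_, rfl⟩ := exists_addCommGroup h
  have : Fact p.Prime := ⟨hp⟩
  let : Module (ZMod p) G := AddCommGroup.zmodModule hG
  let : Module (ZMod p) M :=
    AddCommGroup.zmodModule (ElementarilyEquivalent.forall_nsmul_eq_zero h hG)
  obtain ⟨e⟩ := nonempty_linearEquiv_of_finite (K := ZMod p) hM.symm
  exact ⟨groupEquiv e.toAddEquiv⟩

theorem isModelOfCategorical_of_divisible {G : Type u} [AddCommGroup G] [Uncountable G]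
    (hdiv : ∀ n : ℕ, n ≠ 0 → ∀ g : G, ∃ h : G, n • h = g)
    (htf : ∀ n : ℕ, n ≠ 0 → ∀ g : G, n • g = 0 → g = 0) : IsModelOfCategorical groupLang G := by
  refine isModelOfCategorical_of_elementarilyEquivalent fun M _ h hM => ?_
  obtain ⟨_, rfl⟩ := exists_addCommGroup h
  obtain ⟨_⟩ := nonempty_module_fractionRing hdiv htf
  obtain ⟨_⟩ := nonempty_module_fractionRing
    (fun n hn => ElementarilyEquivalent.exists_nsmul_eq h (hdiv n hn))
    (fun n hn => ElementarilyEquivalent.eq_zero_of_nsmul_eq_zero h (htf n hn))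
  have : Countable (FractionRing ℤ) :=
    Function.Surjective.countable (f := fun x : ℤ × nonZeroDivisors ℤ => Localization.mk x.1 x.2)
      fun x => Localization.induction_on x fun y => ⟨y, rfl⟩
  have hK : #(FractionRing ℤ) ≤ ℵ₀ := Cardinal.mk_le_aleph0
  have hrank : ∀ (V : Type u) [AddCommGroup V] [Module (FractionRing ℤ) V], #V = #G →
      Module.rank (FractionRing ℤ) V = #G := fun V _ _ hV => by
    rw [← hV]
    have : Infinite (FractionRing ℤ) := inferInstance
    refine Module.Free.rank_eq_mk_of_infinite_lt _ _ ?_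
    rw [hV, Cardinal.lift_uzero]
    exact (Cardinal.lift_le_aleph0.2 hK).trans_lt (Cardinal.aleph0_lt_mk)
  obtain ⟨e⟩ := nonempty_linearEquiv_of_rank_eq ((hrank G rfl).trans (hrank M hM).symm)
  exact ⟨groupEquiv e.toAddEquiv⟩

/-! ### Algebraically closed fields -/

/-- The term `s + t`. -/
def fieldAdd {α : Type} (s t : fieldLang.Term α) : fieldLang.Term α :=
  Functions.apply₂ (L := fieldLang) FieldFunc.add s t

/-- The term `s * t`. -/
def fieldMul {α : Type} (s t : fieldLang.Term α) : fieldLang.Term α :=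
  Functions.apply₂ (L := fieldLang) FieldFunc.mul s t

/-- The term `0`. -/
def fieldZero {α : Type} : fieldLang.Term α :=
  Constants.term (L := fieldLang) FieldFunc.zero

/-- The term `1`. -/
def fieldOne {α : Type} : fieldLang.Term α :=
  Constants.term (L := fieldLang) FieldFunc.one

/-- The term `0 + 1 + ⋯ + 1` with `n` ones. -/
def fieldNatCast {α : Type} (n : ℕ) : fieldLang.Term α :=
  match n with
  | 0 => fieldZero
  | n + 1 => fieldAdd (fieldNatCast n) fieldOne

/-- The term `1 * t * ⋯ * t` with `n` factors `t`. -/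
def fieldPow {α : Type} (t : fieldLang.Term α) (n : ℕ) : fieldLang.Term α :=
  match n with
  | 0 => fieldOne
  | n + 1 => fieldMul (fieldPow t n) t

/-- The sum of a list of terms. -/
def fieldSum {α : Type} (l : List (fieldLang.Term α)) : fieldLang.Term α :=
  l.foldr fieldAdd fieldZero

section

variable {F : Type*} [Field F] {α : Type} (v : α → F)

@[simp]
theorem realize_fieldAdd (s t : fieldLang.Term α) :
    (fieldAdd s t).realize v = s.realize v + t.realize v :=
  Term.realize_functions_apply₂

@[simp]
theorem realize_fieldMul (s t : fieldLang.Term α) :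
    (fieldMul s t).realize v = s.realize v * t.realize v :=
  Term.realize_functions_apply₂

@[simp]
theorem realize_fieldZero : (fieldZero : fieldLang.Term α).realize v = 0 :=
  Term.realize_constants

@[simp]
theorem realize_fieldOne : (fieldOne : fieldLang.Term α).realize v = 1 :=
  Term.realize_constants

@[simp]
theorem realize_fieldNatCast (n : ℕ) : (fieldNatCast n : fieldLang.Term α).realize v = n := by
  induction n with
  | zero => simp [fieldNatCast]
  | succ n ih => simp [fieldNatCast, ih]

@[simp]
theorem realize_fieldPow (t : fieldLang.Term α) (n : ℕ) :
    (fieldPow t n).realize v = t.realize v ^ n := by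
  induction n with
  | zero => simp [fieldPow]
  | succ n ih => simp [fieldPow, ih, pow_succ]

@[simp]
theorem realize_fieldSum (l : List (fieldLang.Term α)) :
    (fieldSum l).realize v = (l.map (·.realize v)).sum := by
  induction l with
  | nil => simp [fieldSum]
  | cons t l ih => simpa [fieldSum] using ih

end

/-- A structure elementarily equivalent to a field is a field. -/
theorem exists_field {F M : Type*} [Field F] [inst : fieldLang.Structure M]
    (h : F ≅[fieldLang] M) : ∃ i : Field M, @fieldStructure M i = inst := by
  let : Add M := ⟨fun x y => Structure.funMap (L := fieldLang) FieldFunc.add ![x, y]⟩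
  let : Mul M := ⟨fun x y => Structure.funMap (L := fieldLang) FieldFunc.mul ![x, y]⟩
  let : Zero M := ⟨Structure.funMap (L := fieldLang) FieldFunc.zero ![]⟩
  let : One M := ⟨Structure.funMap (L := fieldLang) FieldFunc.one ![]⟩
  have hadd : ∀ {α : Type} (v : α → M) (s t : fieldLang.Term α),
      (fieldAdd s t).realize v = s.realize v + t.realize v :=
    fun _ _ _ => Term.realize_functions_apply₂
  have hmul : ∀ {α : Type} (v : α → M) (s t : fieldLang.Term α),
      (fieldMul s t).realize v = s.realize v * t.realize v :=
    fun _ _ _ => Term.realize_functions_apply₂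
  have hzero : ∀ {α : Type} (v : α → M), (fieldZero : fieldLang.Term α).realize v = 0 :=
    fun _ => Term.realize_constants
  have hone : ∀ {α : Type} (v : α → M), (fieldOne : fieldLang.Term α).realize v = 1 :=
    fun _ => Term.realize_constants
  have add_assoc' : ∀ x y z : M, x + y + z = x + (y + z) := fun x y z => by
    have := (h.forall_realize_iff (fieldAdd (fieldAdd (&0) (&1)) (&2) ='
      fieldAdd (&0) (fieldAdd (&1) (&2)) : fieldLang.BoundedFormula Empty 3)).1
      (fun x => by simp [add_assoc]) ![x, y, z]
    simpa [hadd] using this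
  have add_comm' : ∀ x y : M, x + y = y + x := fun x y => by
    have := (h.forall_realize_iff (fieldAdd (&0) (&1) =' fieldAdd (&1) (&0) :
      fieldLang.BoundedFormula Empty 2)).1 (fun x => by simp [add_comm]) ![x, y]
    simpa [hadd] using this
  have zero_add' : ∀ x : M, 0 + x = x := fun x => by
    have := (h.forall_realize_iff (fieldAdd fieldZero (&0) =' &0 :
      fieldLang.BoundedFormula Empty 1)).1 (fun x => by simp) ![x]
    simpa [hadd, hzero] using this
  have neg' : ∀ x : M, ∃ y, y + x = 0 := fun x => by
    have := (h.forall_realize_iff (∃' (fieldAdd (&1) (&0) =' fieldZero) :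
      fieldLang.BoundedFormula Empty 1)).1 (fun x => by
        simpa [Fin.snoc] using ⟨-x 0, neg_add_cancel _⟩) ![x]
    simpa [hadd, hzero, Fin.snoc] using this
  have mul_assoc' : ∀ x y z : M, x * y * z = x * (y * z) := fun x y z => by
    have := (h.forall_realize_iff (fieldMul (fieldMul (&0) (&1)) (&2) ='
      fieldMul (&0) (fieldMul (&1) (&2)) : fieldLang.BoundedFormula Empty 3)).1
      (fun x => by simp [mul_assoc]) ![x, y, z]
    simpa [hmul] using this
  have mul_comm' : ∀ x y : M, x * y = y * x := fun x y => by
    have := (h.forall_realize_iff (fieldMul (&0) (&1) =' fieldMul (&1) (&0) :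
      fieldLang.BoundedFormula Empty 2)).1 (fun x => by simp [mul_comm]) ![x, y]
    simpa [hmul] using this
  have one_mul' : ∀ x : M, 1 * x = x := fun x => by
    have := (h.forall_realize_iff (fieldMul fieldOne (&0) =' &0 :
      fieldLang.BoundedFormula Empty 1)).1 (fun x => by simp) ![x]
    simpa [hmul, hone] using this
  have zero_mul' : ∀ x : M, 0 * x = 0 := fun x => by
    have := (h.forall_realize_iff (fieldMul fieldZero (&0) =' fieldZero :
      fieldLang.BoundedFormula Empty 1)).1 (fun x => by simp) ![x]
    simpa [hmul, hzero] using this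
  have mul_add' : ∀ x y z : M, x * (y + z) = x * y + x * z := fun x y z => by
    have := (h.forall_realize_iff (fieldMul (&0) (fieldAdd (&1) (&2)) ='
      fieldAdd (fieldMul (&0) (&1)) (fieldMul (&0) (&2)) : fieldLang.BoundedFormula Empty 3)).1
      (fun x => by simp [mul_add]) ![x, y, z]
    simpa [hadd, hmul] using this
  have inv' : ∀ x : M, x ≠ 0 → ∃ y, x * y = 1 := fun x hx => by
    have := (h.forall_realize_iff
      ((∼(&0 =' fieldZero)) ⟹ ∃' (fieldMul (&0) (&1) =' fieldOne) :
        fieldLang.BoundedFormula Empty 1)).1 (fun x => by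
        simpa [Fin.snoc] using fun hx => ⟨(x 0)⁻¹, mul_inv_cancel₀ hx⟩) ![x]
    simpa [hmul, hzero, hone, Fin.snoc, hx] using this
  have zero_ne_one' : (0 : M) ≠ 1 := by
    have := (h.forall_realize_iff (∼(fieldZero =' fieldOne) :
      fieldLang.BoundedFormula Empty 0)).1 (fun x => by simp) ![]
    simpa [hzero, hone] using this
  choose neg hneg using neg'
  let : Neg M := ⟨neg⟩
  let : CommRing M :=
    { add_assoc := add_assoc', add_comm := add_comm', zero_add := zero_add',
      add_zero := fun x => by rw [add_comm', zero_add'],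
      neg_add_cancel := hneg, nsmul := nsmulRec, zsmul := zsmulRec,
      mul_assoc := mul_assoc', mul_comm := mul_comm', one_mul := one_mul',
      mul_one := fun x => by rw [mul_comm', one_mul'],
      zero_mul := zero_mul', mul_zero := fun x => by rw [mul_comm', zero_mul'],
      left_distrib := mul_add',
      right_distrib := fun x y z => by rw [mul_comm', mul_add', mul_comm' x, mul_comm' y] }
  have hM : IsField M := ⟨⟨0, 1, zero_ne_one'⟩, mul_comm', fun {x} hx => inv' x hx⟩
  refine ⟨hM.toField, ?_⟩
  refine Structure.ext ?_ ?_
  · funext n f x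
    cases f with
    | add => exact congrArg (Structure.funMap (L := fieldLang) FieldFunc.add) (vecCons_two_eq x)
    | mul => exact congrArg (Structure.funMap (L := fieldLang) FieldFunc.mul) (vecCons_two_eq x)
    | zero =>
      exact congrArg (Structure.funMap (L := fieldLang) FieldFunc.zero) (Subsingleton.elim ![] x)
    | one =>
      exact congrArg (Structure.funMap (L := fieldLang) FieldFunc.one) (Subsingleton.elim ![] x)
  · funext n r
    exact r.elim

/-- A ring isomorphism is an isomorphism of structures. -/
def fieldEquiv {F K : Type*} [Field F] [Field K] (e : F ≃+* K) : F ≃[fieldLang] K where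
  toEquiv := e.toEquiv
  map_fun' f x := by
    cases f with
    | add => exact map_add e _ _
    | mul => exact map_mul e _ _
    | zero => exact map_zero e
    | one => exact map_one e
  map_rel' r := r.elim

theorem card_fieldLang_le : fieldLang.card ≤ ℵ₀ := by
  have : Countable fieldLang.Symbols := by
    have : ∀ l, Finite (FieldFunc l) := fun l => by
      refine Finite.of_injective (β := Fin 4) (fun f => match f with
        | .add => 0 | .mul => 1 | .zero => 2 | .one => 3) fun f g h => ?_
      cases f <;> cases g <;> simp_all
    have : Countable (Σ l, fieldLang.Functions l) :=
      inferInstanceAs (Countable (Σ l, FieldFunc l))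
    have : Countable (Σ l, fieldLang.Relations l) :=
      have : IsEmpty (Σ l, fieldLang.Relations l) := ⟨fun x => x.2.elim⟩
      inferInstance
    exact inferInstanceAs (Countable (_ ⊕ _))
  exact Cardinal.mk_le_aleph0

/-- Whether `n = 0` holds is expressed by a sentence for each `n`. -/
theorem charP_of_elementarilyEquivalent {F M : Type*} [Field F] [Field M]
    (h : F ≅[fieldLang] M) (p : ℕ) [CharP F p] : CharP M p where
  cast_eq_zero_iff n := by
    have := h.forall_realize_iff (fieldNatCast n =' fieldZero :
      fieldLang.BoundedFormula Empty 0)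
    simp only [BoundedFormula.realize_bdEqual, realize_fieldNatCast, realize_fieldZero,
      forall_const] at this
    rw [← this, CharP.cast_eq_zero_iff F p]

open Polynomial in
/-- For each degree, the sentence saying that every monic polynomial of that degree has a root is
transferred. -/
theorem isAlgClosed_of_elementarilyEquivalent {F M : Type*} [Field F] [Field M] [IsAlgClosed F]
    (h : F ≅[fieldLang] M) : IsAlgClosed M := by
  refine IsAlgClosed.of_exists_root _ fun p hp hirr => ?_
  have hn : p.natDegree ≠ 0 := (natDegree_pos_iff_degree_pos.2 (degree_pos_of_irreducible hirr)).ne'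
  have := (h.forall_realize_iff (∃' (fieldAdd (fieldPow (&(Fin.last _)) p.natDegree)
    (fieldSum (List.ofFn fun i : Fin p.natDegree =>
      fieldMul (&i.castSucc) (fieldPow (&(Fin.last _)) i))) =' fieldZero) :
    fieldLang.BoundedFormula Empty p.natDegree)).1 (fun v => ?_) (fun i => p.coeff i)
  · simp only [BoundedFormula.realize_ex, BoundedFormula.realize_bdEqual, realize_fieldAdd,
      realize_fieldPow, realize_fieldSum, realize_fieldZero, List.map_ofFn, List.sum_ofFn,
      Function.comp_apply, realize_fieldMul, Term.realize_var, Sum.elim_inr, Fin.snoc_last,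
      Fin.snoc_castSucc] at this
    obtain ⟨x, hx⟩ := this
    refine ⟨x, ?_⟩
    conv_lhs => rw [hp.as_sum]
    simpa [eval_finsetSum, Finset.sum_range] using hx
  · have hdeg : (∑ i : Fin p.natDegree, C (v i) * X ^ (i : ℕ)).degree < (p.natDegree : WithBot ℕ) :=
      degree_sum_fin_lt v
    obtain ⟨x, hx⟩ := IsAlgClosed.exists_root
      (X ^ p.natDegree + ∑ i : Fin p.natDegree, C (v i) * X ^ (i : ℕ)) (by
        rw [degree_add_eq_left_of_degree_lt (by rwa [degree_X_pow]), degree_X_pow]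
        exact_mod_cast hn)
    simp only [BoundedFormula.realize_ex, BoundedFormula.realize_bdEqual, realize_fieldAdd,
      realize_fieldPow, realize_fieldSum, realize_fieldZero, List.map_ofFn, List.sum_ofFn,
      Function.comp_apply, realize_fieldMul, Term.realize_var, Sum.elim_inr, Fin.snoc_last,
      Fin.snoc_castSucc]
    exact ⟨x, by simpa [eval_finsetSum] using hx⟩

theorem isModelOfCategorical_of_isAlgClosed {F : Type*} [Field F] [IsAlgClosed F]
    [Uncountable F] : IsModelOfCategorical fieldLang F := by
  refine isModelOfCategorical_of_elementarilyEquivalent fun M _ h hM => ?_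
  obtain ⟨_, rfl⟩ := exists_field h
  have := isAlgClosed_of_elementarilyEquivalent h
  have := charP_of_elementarilyEquivalent h (ringChar F)
  obtain ⟨e⟩ := IsAlgClosed.ringEquiv_of_equiv_of_char_eq (K := F) (L := M) (ringChar F)
    Cardinal.aleph0_lt_mk (Cardinal.eq.1 hM.symm)
  exact ⟨fieldEquiv e⟩

/-! ### Atomless Boolean algebras -/

/-- The term `s ⊔ t`. -/
def boolSup {α : Type} (s t : boolLang.Term α) : boolLang.Term α :=
  Functions.apply₂ (L := boolLang) BoolFunc.sup s t

/-- The term `s ⊓ t`. -/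
def boolInf {α : Type} (s t : boolLang.Term α) : boolLang.Term α :=
  Functions.apply₂ (L := boolLang) BoolFunc.inf s t

/-- The term `tᶜ`. -/
def boolCompl {α : Type} (t : boolLang.Term α) : boolLang.Term α :=
  Functions.apply₁ (L := boolLang) BoolFunc.compl t

/-- The term `⊥`. -/
def boolBot {α : Type} : boolLang.Term α :=
  Constants.term (L := boolLang) BoolFunc.bot

/-- The term `⊤`. -/
def boolTop {α : Type} : boolLang.Term α :=
  Constants.term (L := boolLang) BoolFunc.top

section

variable {B : Type*} [BooleanAlgebra B] {α : Type} (v : α → B)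

@[simp]
theorem realize_boolSup (s t : boolLang.Term α) :
    (boolSup s t).realize v = s.realize v ⊔ t.realize v :=
  Term.realize_functions_apply₂

@[simp]
theorem realize_boolInf (s t : boolLang.Term α) :
    (boolInf s t).realize v = s.realize v ⊓ t.realize v :=
  Term.realize_functions_apply₂

@[simp]
theorem realize_boolCompl (t : boolLang.Term α) :
    (boolCompl t).realize v = (t.realize v)ᶜ :=
  Term.realize_functions_apply₁

@[simp]
theorem realize_boolBot : (boolBot : boolLang.Term α).realize v = ⊥ :=
  Term.realize_constants

@[simp]
theorem realize_boolTop : (boolTop : boolLang.Term α).realize v = ⊤ :=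
  Term.realize_constants

end

/-- A structure elementarily equivalent to a Boolean algebra is a Boolean algebra. -/
theorem exists_booleanAlgebra {B M : Type*} [BooleanAlgebra B] [inst : boolLang.Structure M]
    (h : B ≅[boolLang] M) : ∃ i : BooleanAlgebra M, @boolStructure M i = inst := by
  let : Max M := ⟨fun x y => Structure.funMap (L := boolLang) BoolFunc.sup ![x, y]⟩
  let : Min M := ⟨fun x y => Structure.funMap (L := boolLang) BoolFunc.inf ![x, y]⟩
  let : Compl M := ⟨fun x => Structure.funMap (L := boolLang) BoolFunc.compl ![x]⟩
  let : Bot M := ⟨Structure.funMap (L := boolLang) BoolFunc.bot ![]⟩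
  let : Top M := ⟨Structure.funMap (L := boolLang) BoolFunc.top ![]⟩
  have hsup : ∀ {α : Type} (v : α → M) (s t : boolLang.Term α),
      (boolSup s t).realize v = s.realize v ⊔ t.realize v :=
    fun _ _ _ => Term.realize_functions_apply₂
  have hinf : ∀ {α : Type} (v : α → M) (s t : boolLang.Term α),
      (boolInf s t).realize v = s.realize v ⊓ t.realize v :=
    fun _ _ _ => Term.realize_functions_apply₂
  have hcompl : ∀ {α : Type} (v : α → M) (t : boolLang.Term α),
      (boolCompl t).realize v = (t.realize v)ᶜ :=
    fun _ _ => Term.realize_functions_apply₁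
  have hbot : ∀ {α : Type} (v : α → M), (boolBot : boolLang.Term α).realize v = ⊥ :=
    fun _ => Term.realize_constants
  have htop : ∀ {α : Type} (v : α → M), (boolTop : boolLang.Term α).realize v = ⊤ :=
    fun _ => Term.realize_constants
  have sup_comm' : ∀ x y : M, x ⊔ y = y ⊔ x := fun x y => by
    have := (h.forall_realize_iff (boolSup (&0) (&1) =' boolSup (&1) (&0) :
      boolLang.BoundedFormula Empty 2)).1 (fun x => by simp [sup_comm]) ![x, y]
    simpa [hsup] using this
  have inf_comm' : ∀ x y : M, x ⊓ y = y ⊓ x := fun x y => by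
    have := (h.forall_realize_iff (boolInf (&0) (&1) =' boolInf (&1) (&0) :
      boolLang.BoundedFormula Empty 2)).1 (fun x => by simp [inf_comm]) ![x, y]
    simpa [hinf] using this
  have sup_assoc' : ∀ x y z : M, x ⊔ y ⊔ z = x ⊔ (y ⊔ z) := fun x y z => by
    have := (h.forall_realize_iff (boolSup (boolSup (&0) (&1)) (&2) ='
      boolSup (&0) (boolSup (&1) (&2)) : boolLang.BoundedFormula Empty 3)).1
      (fun x => by simp [sup_assoc]) ![x, y, z]
    simpa [hsup] using this
  have inf_assoc' : ∀ x y z : M, x ⊓ y ⊓ z = x ⊓ (y ⊓ z) := fun x y z => by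
    have := (h.forall_realize_iff (boolInf (boolInf (&0) (&1)) (&2) ='
      boolInf (&0) (boolInf (&1) (&2)) : boolLang.BoundedFormula Empty 3)).1
      (fun x => by simp [inf_assoc]) ![x, y, z]
    simpa [hinf] using this
  have sup_inf_self' : ∀ x y : M, x ⊔ x ⊓ y = x := fun x y => by
    have := (h.forall_realize_iff (boolSup (&0) (boolInf (&0) (&1)) =' &0 :
      boolLang.BoundedFormula Empty 2)).1 (fun x => by simp) ![x, y]
    simpa [hsup, hinf] using this
  have inf_sup_self' : ∀ x y : M, x ⊓ (x ⊔ y) = x := fun x y => by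
    have := (h.forall_realize_iff (boolInf (&0) (boolSup (&0) (&1)) =' &0 :
      boolLang.BoundedFormula Empty 2)).1 (fun x => by simp) ![x, y]
    simpa [hsup, hinf] using this
  have sup_inf_left' : ∀ x y z : M, x ⊔ y ⊓ z = (x ⊔ y) ⊓ (x ⊔ z) := fun x y z => by
    have := (h.forall_realize_iff (boolSup (&0) (boolInf (&1) (&2)) ='
      boolInf (boolSup (&0) (&1)) (boolSup (&0) (&2)) : boolLang.BoundedFormula Empty 3)).1
      (fun x => by simp [sup_inf_left]) ![x, y, z]
    simpa [hsup, hinf] using this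
  have inf_compl' : ∀ x : M, x ⊓ xᶜ = ⊥ := fun x => by
    have := (h.forall_realize_iff (boolInf (&0) (boolCompl (&0)) =' boolBot :
      boolLang.BoundedFormula Empty 1)).1 (fun x => by simp) ![x]
    simpa [hinf, hcompl, hbot] using this
  have sup_compl' : ∀ x : M, x ⊔ xᶜ = ⊤ := fun x => by
    have := (h.forall_realize_iff (boolSup (&0) (boolCompl (&0)) =' boolTop :
      boolLang.BoundedFormula Empty 1)).1 (fun x => by simp) ![x]
    simpa [hsup, hcompl, htop] using this
  have sup_top' : ∀ x : M, x ⊔ ⊤ = ⊤ := fun x => by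
    have := (h.forall_realize_iff (boolSup (&0) boolTop =' boolTop :
      boolLang.BoundedFormula Empty 1)).1 (fun x => by simp) ![x]
    simpa [hsup, htop] using this
  have bot_sup' : ∀ x : M, ⊥ ⊔ x = x := fun x => by
    have := (h.forall_realize_iff (boolSup boolBot (&0) =' &0 :
      boolLang.BoundedFormula Empty 1)).1 (fun x => by simp) ![x]
    simpa [hsup, hbot] using this
  let : Lattice M := Lattice.mk' sup_comm' sup_assoc' inf_comm' inf_assoc' sup_inf_self'
    inf_sup_self'
  refine ⟨{ le_sup_inf := fun x y z => (sup_inf_left' x y z).ge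
            inf_compl_le_bot := fun x => (inf_compl' x).le
            top_le_sup_compl := fun x => (sup_compl' x).ge
            le_top := fun x => sup_eq_right.1 (sup_top' x)
            bot_le := fun x => sup_eq_right.1 (bot_sup' x) }, ?_⟩
  refine Structure.ext ?_ ?_
  · funext n f x
    cases f with
    | sup => exact congrArg (Structure.funMap (L := boolLang) BoolFunc.sup) (vecCons_two_eq x)
    | inf => exact congrArg (Structure.funMap (L := boolLang) BoolFunc.inf) (vecCons_two_eq x)
    | compl =>
      refine congrArg (Structure.funMap (L := boolLang) BoolFunc.compl) (a₁ := ![x 0]) ?_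
      funext i
      fin_cases i
      rfl
    | bot =>
      exact congrArg (Structure.funMap (L := boolLang) BoolFunc.bot) (Subsingleton.elim ![] x)
    | top =>
      exact congrArg (Structure.funMap (L := boolLang) BoolFunc.top) (Subsingleton.elim ![] x)
  · funext n r
    exact r.elim

/-- An order isomorphism of Boolean algebras is an isomorphism of structures. -/
def boolEquiv {B C : Type*} [BooleanAlgebra B] [BooleanAlgebra C] (e : B ≃o C) :
    B ≃[boolLang] C where
  toEquiv := e.toEquiv
  map_fun' f x := by
    cases f with
    | sup => exact map_sup e _ _
    | inf => exact map_inf e _ _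
    | compl => exact map_compl' e _
    | bot => exact map_bot e
    | top => exact map_top e
  map_rel' r := r.elim

theorem card_boolLang_le : boolLang.card ≤ ℵ₀ := by
  have : Countable boolLang.Symbols := by
    have : ∀ l, Finite (BoolFunc l) := fun l => by
      refine Finite.of_injective (β := Fin 5) (fun f => match f with
        | .sup => 0 | .inf => 1 | .compl => 2 | .bot => 3 | .top => 4) fun f g h => ?_
      cases f <;> cases g <;> simp_all
    have : Countable (Σ l, boolLang.Functions l) :=
      inferInstanceAs (Countable (Σ l, BoolFunc l))
    have : Countable (Σ l, boolLang.Relations l) :=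
      have : IsEmpty (Σ l, boolLang.Relations l) := ⟨fun x => x.2.elim⟩
      inferInstance
    exact inferInstanceAs (Countable (_ ⊕ _))
  exact Cardinal.mk_le_aleph0

/-! ### The back-and-forth argument -/

section

variable {B C : Type*} [BooleanAlgebra B] [BooleanAlgebra C]

/-- The pairs of the list `l` have the same relative position below `c` as below `d`: every
Boolean combination of their first components and `c` that has the form
`c ⊓ ±x₁ ⊓ ⋯ ⊓ ±xₖ` is zero if and only if the corresponding combination of their second components
and `d` is. -/
def Similar : List (B × C) → B → C → Prop
  | [], c, d => c = ⊥ ↔ d = ⊥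
  | p :: l, c, d => Similar l (c ⊓ p.1) (d ⊓ p.2) ∧ Similar l (c \ p.1) (d \ p.2)

theorem Similar.eq_bot_iff {l : List (B × C)} {c : B} {d : C} (h : Similar l c d) :
    c = ⊥ ↔ d = ⊥ := by
  induction l generalizing c d with
  | nil => exact h
  | cons p l ih =>
    rw [← sup_inf_sdiff c p.1, ← sup_inf_sdiff d p.2, sup_eq_bot_iff, sup_eq_bot_iff,
      ih h.1, ih h.2]

theorem similar_bot (l : List (B × C)) : Similar l ⊥ ⊥ := by
  induction l with
  | nil => simp [Similar]
  | cons p l ih => simpa [Similar] using ih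

/-- Splitting `c` and `d` by a pair that is already in the list preserves similarity. -/
theorem Similar.restrict {l : List (B × C)} {c : B} {d : C} (h : Similar l c d) {p : B × C}
    (hp : p ∈ l) : Similar l (c ⊓ p.1) (d ⊓ p.2) ∧ Similar l (c \ p.1) (d \ p.2) := by
  induction l generalizing c d with
  | nil => simp at hp
  | cons q l ih =>
    rcases List.mem_cons.1 hp with rfl | hp
    · simp only [Similar, sdiff_eq] at h ⊢
      simp only [inf_assoc, inf_idem, inf_compl_self, compl_inf_self, inf_bot_eq]
      exact ⟨⟨h.1, similar_bot l⟩, similar_bot l, h.2⟩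
    · have h₁ := ih h.1 hp
      have h₂ := ih h.2 hp
      simp only [Similar, sdiff_eq] at h₁ h₂ ⊢
      simp only [inf_right_comm _ p.1, inf_right_comm _ p.2, inf_right_comm _ p.1ᶜ,
        inf_right_comm _ p.2ᶜ]
      exact ⟨⟨h₁.1, h₂.1⟩, h₁.2, h₂.2⟩

/-- The inequality `x ≤ y` means that `⊤ ⊓ x \ y` is zero. -/
theorem Similar.le_iff_le {l : List (B × C)} (h : Similar l ⊤ ⊤) {p q : B × C} (hp : p ∈ l)
    (hq : q ∈ l) : p.1 ≤ q.1 ↔ p.2 ≤ q.2 := by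
  have := ((h.restrict hp).1.restrict hq).2.eq_bot_iff
  simpa using this

theorem Similar.symm {l : List (B × C)} {c : B} {d : C} (h : Similar l c d) :
    Similar (l.map Prod.swap) d c := by
  induction l generalizing c d with
  | nil => exact Iff.symm h
  | cons p l ih => exact ⟨ih h.1, ih h.2⟩

/-- In an atomless Boolean algebra, below `d` there is an element `y` such that `y` and `d \ y` are
zero or not as prescribed. -/
theorem exists_split (hC : ∀ b : C, ¬ IsAtom b) {c : B} {d : C} (h : c = ⊥ ↔ d = ⊥) (x : B) :
    ∃ y ≤ d, (c ⊓ x = ⊥ ↔ y = ⊥) ∧ (c \ x = ⊥ ↔ d \ y = ⊥) := by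
  by_cases h₁ : c ⊓ x = ⊥
  · refine ⟨⊥, bot_le, by simp [h₁], ?_⟩
    rw [sdiff_bot, ← h, sdiff_eq_left.2 (disjoint_iff.2 h₁)]
  · by_cases h₂ : c \ x = ⊥
    · refine ⟨d, le_rfl, ?_, by simp [h₂]⟩
      rw [← h, inf_eq_left.2 (sdiff_eq_bot_iff.1 h₂)]
    -- Both parts of `c` are nonzero, so `d` has to be split properly, which is possible as it is not
    -- an atom.
    · have hd : d ≠ ⊥ := fun hd => h₁ (by rw [h.2 hd, bot_inf_eq])
      obtain ⟨y, hyd, hy⟩ : ∃ y < d, y ≠ ⊥ := by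
        by_contra! hne
        exact hC d ⟨hd, hne⟩
      refine ⟨y, hyd.le, by simp [h₁, hy], ?_⟩
      simpa [h₂] using hyd.not_ge

/-- Only the part of `y` below `d` matters. -/
theorem similar_append_congr (l : List (B × C)) (x : B) {c : B} {d y y' : C} (h : d ⊓ y = d ⊓ y') :
    Similar (l ++ [(x, y)]) c d ↔ Similar (l ++ [(x, y')]) c d := by
  induction l generalizing c d with
  | nil =>
    have : d \ y = d \ y' := by rw [← sdiff_inf_self_left, h, sdiff_inf_self_left]
    simp [Similar, h, this]
  | cons p l ih =>
    simp only [List.cons_append, Similar]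
    rw [ih (d := d ⊓ p.2) (by rw [inf_right_comm, h, inf_right_comm]),
      ih (d := d \ p.2) (by rw [sdiff_eq, inf_right_comm, h, inf_right_comm])]

/-- Every element `x` on the left has a counterpart `y` on the right: it is the join of the
counterparts found below the two parts into which the first pair of the list splits `c` and `d`. -/
theorem Similar.exists_append (hC : ∀ b : C, ¬ IsAtom b) {l : List (B × C)} {c : B} {d : C}
    (h : Similar l c d) (x : B) : ∃ y ≤ d, Similar (l ++ [(x, y)]) c d := by
  induction l generalizing c d with
  | nil =>
    obtain ⟨y, hy, h₁, h₂⟩ := exists_split hC h x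
    exact ⟨y, hy, by rwa [← inf_eq_right.2 hy] at h₁, h₂⟩
  | cons p l ih =>
    obtain ⟨y₁, hy₁, h₁⟩ := ih h.1
    obtain ⟨y₂, hy₂, h₂⟩ := ih h.2
    have e₁ : d ⊓ p.2 ⊓ (y₁ ⊔ y₂) = d ⊓ p.2 ⊓ y₁ := by
      have : Disjoint (d ⊓ p.2) y₂ :=
        (disjoint_sdiff_self_right.mono_left inf_le_right).mono_right hy₂
      rw [inf_sup_left, this.eq_bot, sup_bot_eq]
    have e₂ : d \ p.2 ⊓ (y₁ ⊔ y₂) = d \ p.2 ⊓ y₂ := by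
      have : Disjoint (d \ p.2) y₁ :=
        (disjoint_sdiff_self_left.mono_right inf_le_right).mono_right hy₁
      rw [inf_sup_left, this.eq_bot, bot_sup_eq]
    exact ⟨y₁ ⊔ y₂, sup_le (hy₁.trans inf_le_left) (hy₂.trans sdiff_le),
      (similar_append_congr l x e₁).2 h₁, (similar_append_congr l x e₂).2 h₂⟩

end

/-- Finite partial isomorphisms of Boolean algebras, as lists of corresponding elements, ordered by
extension. -/
def PartialBoolIso (B C : Type*) [BooleanAlgebra B] [BooleanAlgebra C] : Type _ :=
  {l : List (B × C) // Similar l ⊤ ⊤}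

instance {B C : Type*} [BooleanAlgebra B] [BooleanAlgebra C] : Preorder (PartialBoolIso B C) where
  le f g := f.1 ⊆ g.1
  le_refl f := List.Subset.refl f.1
  le_trans _ _ _ := List.Subset.trans

/-- Two countable atomless Boolean algebras are isomorphic. -/
theorem nonempty_orderIso_of_countable {B C : Type*} [BooleanAlgebra B] [BooleanAlgebra C]
    [Nontrivial B] [Nontrivial C] [Countable B] [Countable C] (hB : ∀ b : B, ¬ IsAtom b)
    (hC : ∀ c : C, ¬ IsAtom c) : Nonempty (B ≃o C) := by
  cases nonempty_encodable B
  cases nonempty_encodable C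
  let left (x : B) : Order.Cofinal (PartialBoolIso B C) :=
    { carrier := {f | ∃ y, (x, y) ∈ f.1}
      isCofinal := fun f => by
        obtain ⟨y, -, hy⟩ := f.2.exists_append hC x
        exact ⟨⟨_, hy⟩, ⟨y, by simp⟩, List.subset_append_left _ _⟩ }
  let right (y : C) : Order.Cofinal (PartialBoolIso B C) :=
    { carrier := {f | ∃ x, (x, y) ∈ f.1}
      isCofinal := fun f => by
        obtain ⟨x, -, hx⟩ := f.2.symm.exists_append hB y
        have hx := hx.symm
        rw [List.map_append, List.map_map, Prod.swap_swap_eq, List.map_id] at hx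
        exact ⟨⟨_, hx⟩, ⟨x, by simp⟩, List.subset_append_left _ _⟩ }
  let bot : PartialBoolIso B C := ⟨[], by simp [Similar]⟩
  -- A directed family of partial isomorphisms that is defined at every element of `B` and of `C`.
  let I := Order.idealOfCofinals bot (Sum.elim left right)
  have hle : ∀ p q : B × C, (∃ f ∈ I, p ∈ f.1) → (∃ f ∈ I, q ∈ f.1) →
      (p.1 ≤ q.1 ↔ p.2 ≤ q.2) := by
    rintro p q ⟨f, hf, hp⟩ ⟨g, hg, hq⟩
    obtain ⟨k, -, hfk, hgk⟩ := I.directed _ hf _ hg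
    exact k.2.le_iff_le (hfk hp) (hgk hq)
  have hF : ∀ x : B, ∃ y : C, ∃ f ∈ I, (x, y) ∈ f.1 := fun x => by
    obtain ⟨f, ⟨y, hy⟩, hf⟩ := Order.cofinal_meets_idealOfCofinals
      bot (Sum.elim left right) (.inl x)
    exact ⟨y, f, hf, hy⟩
  have hG : ∀ y : C, ∃ x : B, ∃ f ∈ I, (x, y) ∈ f.1 := fun y => by
    obtain ⟨f, ⟨x, hx⟩, hf⟩ := Order.cofinal_meets_idealOfCofinals
      bot (Sum.elim left right) (.inr y)
    exact ⟨x, f, hf, hx⟩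
  choose F hF using hF
  choose G hG using hG
  exact ⟨{
    toFun := F
    invFun := G
    left_inv := fun x => le_antisymm ((hle _ _ (hG (F x)) (hF x)).2 le_rfl)
      ((hle _ _ (hF x) (hG (F x))).2 le_rfl)
    right_inv := fun y => le_antisymm ((hle _ _ (hF (G y)) (hG y)).1 le_rfl)
      ((hle _ _ (hG y) (hF (G y))).1 le_rfl)
    map_rel_iff' := fun {x x'} => (hle _ _ (hF x) (hF x')).symm }⟩

theorem not_isAtom_of_elementarilyEquivalent {B M : Type*} [BooleanAlgebra B] [BooleanAlgebra M]
    (h : B ≅[boolLang] M) (hB : ∀ b : B, ¬ IsAtom b) (b : M) : ¬ IsAtom b := by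
  have := (h.forall_realize_iff ((∼(&0 =' boolBot)) ⟹ ∃' ((boolInf (&1) (&0) =' &1) ⊓
    (∼(&1 =' boolBot) ⊓ ∼(&1 =' &0))) : boolLang.BoundedFormula Empty 1)).1 (fun x => ?_) ![b]
  · simp at this
    intro hb
    obtain ⟨y, hy, hy₀, hy₁⟩ := this hb.1
    exact hy₀ (hb.2 y (lt_of_le_of_ne hy hy₁))
  · simp [Fin.snoc]
    intro hx
    have := hB (x 0)
    simp only [IsAtom, not_and, not_forall] at this
    obtain ⟨y, hy, hy₀⟩ := this hx
    exact ⟨y, hy.le, hy₀, hy.ne⟩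

theorem isModelOfCategorical_of_atomless {B : Type*} [BooleanAlgebra B] [Nontrivial B]
    [Countable B] (hB : ∀ b : B, ¬ IsAtom b) : IsModelOfCategorical boolLang B := by
  refine isModelOfCategorical_of_elementarilyEquivalent fun M _ h hM => ?_
  obtain ⟨_, rfl⟩ := exists_booleanAlgebra h
  obtain ⟨e⟩ := Cardinal.eq.1 hM
  have := e.nontrivial
  have := e.injective.countable
  obtain ⟨e'⟩ := nonempty_orderIso_of_countable hB (not_isAtom_of_elementarilyEquivalent h hB)
  exact ⟨boolEquiv e'⟩

end ProgSat

theorem corollary1 :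
    -- the countable atomless Boolean algebra
    (∀ (B : Type*) [BooleanAlgebra B] [Nontrivial B] [Countable B],
      (∀ b : B, ¬ IsAtom b) →
        ProgSat.IsModelOfCategorical ProgSat.boolLang B ∧
          ProgSat.ProgramSaturated ProgSat.boolLang B) ∧
    -- abelian groups with all elements of order `p`
    (∀ (p : ℕ) (G : Type*) [AddCommGroup G], p.Prime → (∀ g : G, p • g = 0) →
        ProgSat.IsModelOfCategorical ProgSat.groupLang G ∧
          ProgSat.ProgramSaturated ProgSat.groupLang G) ∧
    -- uncountable divisible torsion-free abelian groups
    (∀ (G : Type*) [AddCommGroup G] [Uncountable G],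
      (∀ n : ℕ, n ≠ 0 → ∀ g : G, ∃ h : G, n • h = g) →
      (∀ n : ℕ, n ≠ 0 → ∀ g : G, n • g = 0 → g = 0) →
        ProgSat.IsModelOfCategorical ProgSat.groupLang G ∧
          ProgSat.ProgramSaturated ProgSat.groupLang G) ∧
    -- in particular, the additive group of real numbers
    (ProgSat.IsModelOfCategorical ProgSat.groupLang ℝ ∧
      ProgSat.ProgramSaturated ProgSat.groupLang ℝ) ∧
    -- uncountable algebraically closed fields (of characteristic zero or a prime)
    (∀ (F : Type*) [Field F] [IsAlgClosed F] [Uncountable F],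
        ProgSat.IsModelOfCategorical ProgSat.fieldLang F ∧
          ProgSat.ProgramSaturated ProgSat.fieldLang F) ∧
    -- in particular, the field of complex numbers
    (ProgSat.IsModelOfCategorical ProgSat.fieldLang ℂ ∧
      ProgSat.ProgramSaturated ProgSat.fieldLang ℂ) := by
  refine ⟨fun B _ _ _ hB => ?_, fun p G _ hp hG => ?_, fun G _ _ hdiv htf => ?_, ?_,
    fun F _ _ _ => ?_, ?_⟩
  · have h := ProgSat.isModelOfCategorical_of_atomless hB
    exact ⟨h, h.programSaturated ProgSat.card_boolLang_le⟩
  · have h := ProgSat.isModelOfCategorical_of_prime_nsmul hp hG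
    exact ⟨h, h.programSaturated ProgSat.card_groupLang_le⟩
  · have h := ProgSat.isModelOfCategorical_of_divisible hdiv htf
    exact ⟨h, h.programSaturated ProgSat.card_groupLang_le⟩
  · have h : ProgSat.IsModelOfCategorical ProgSat.groupLang ℝ := by
      refine ProgSat.isModelOfCategorical_of_divisible (fun n hn g => ⟨g / n, ?_⟩)
        fun n hn g hg => (smul_eq_zero.1 hg).resolve_left hn
      rw [nsmul_eq_mul, mul_div_cancel₀ _ (Nat.cast_ne_zero.2 hn)]
    exact ⟨h, h.programSaturated ProgSat.card_groupLang_le⟩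
  · have h := ProgSat.isModelOfCategorical_of_isAlgClosed (F := F)
    exact ⟨h, h.programSaturated ProgSat.card_fieldLang_le⟩
  · have : Uncountable ℂ := Complex.ofReal_injective.uncountable
    have h := ProgSat.isModelOfCategorical_of_isAlgClosed (F := ℂ)
    exact ⟨h, h.programSaturated ProgSat.card_fieldLang_le⟩
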